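/- **Setting.** Let $\mathcal X$ be a measurable space, $\mathcal P$ a set of probability distributions on it (the model), $P\in\mathcal P$, $\mathcal P_\beta\subset\mathcal P$, and $\beta:\mathcal P_\beta\to\mathbb B$ a parameter with values in a Banach space. A path $(Q_t)_{t\in(0,1]}$ tends to $P$ in quadratic mean with score $g\in L_2(P)$ if $$\int\Bigl[\frac{dQ_t^{1/2}-dP^{1/2}}{t}-\frac12\,g\,dP^{1/2}\Bigr]^2\to0\qquad(t\to0).$$ Let $\mathscr P_P$ be a set of such paths in $\mathcal P$ that is closed under rescaling the index: for $Q_t\in\mathscr P_P$ and $a>0$ it contains a path that equals $Q_{at}$ for all small $t$ and takes only values that $(Q_t)$ takes. Let $\dot{\mathcal P}_P$ be the set of scores of paths in $\mathscr P_P$. The set $\dot{\mathcal P}_{P,\beta}$ consists of those $g\in\dot{\mathcal P}_P$ that are induced by at least one path in $\mathscr P_P$ with values in $\mathcal P_\beta$ and for which $\beta(Q_t)$ converges, as $t\to 0$, to one and the same limit for all such paths; $\mathscr P_{P,\beta}$ is the set of paths in $\mathscr P_P$ with values in $\mathcal P_\beta$ and score in $\dot{\mathcal P}_{P,\beta}$.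 The parameter $\beta$ is weakly regular at $P$ with local map $\beta_P:\dot{\mathcal P}_{P,\beta}\to\mathbb B$ if $\beta_P$ is continuous for the $L_2(P)$-norm, homogeneous of degree zero ($\beta_P(ag)=\beta_P(g)$ for $a>0$), and $\beta(Q_t)\to\beta_P(g)$ for every $Q_t\in\mathscr P_{P,\beta}$ with score $g$; it is nontrivial if $\beta_P$ is nonconstant. Write $Q_n=Q_{1/\sqrt n}$, and let $Q_n^n$ be the law of an i.i.d. sample of size $n$ from $Q_n$. Estimators $\hat\beta_n:\mathcal X^n\to\mathbb B$ and tests $\phi_n:\mathcal X^n\to[0,1]$ are arbitrary maps; convergence in probability and weak convergence are understood with outer probabilities and outer expectations $E^*$. - Estimators $\hat\beta_n$ are consistent along a path $Q_t$ if $\|\hat\beta_n-\beta(Q_n)\|\to0$ in outer probability under $Q_n^n$; they are consistent if this holds along every path in $\mathscr P_{P,\beta}$. - For $B_0,B_1\subset\mathbb B$ and $\alpha<1$, tests $\phi_n$ of $H_0:\beta\in B_0$ against $H_1:\beta\in B_1$ are consistent of level $\alpha$ if $\limsup_n E^*_{Q_n^n}\phi_n\le\alpha$ for every path in $\mathscr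 P_{P,\beta}$ whose score satisfies $\beta_P(g)\in B_0$, and $\phi_n\to1$ in outer probability under $Q_n^n$ for every path in $\mathscr P_{P,\beta}$ whose score satisfies $\beta_P(g)\in B_1$. The testing problem is nontrivial if $B_0$ and $B_1$ each contain a value of $\beta_P$. - Estimators $\hat\beta_n$ are equivariant in law with limit law $L$, a Borel probability measure on $\mathbb B$, if $\hat\beta_n-\beta(Q_n)$ converges weakly to $L$ under $Q_n^n$ for every path in $\mathscr P_{P,\beta}$. The law $L$ is separable if it is concentrated on a separable measurable set. **Theorem (Impossibility of consistent and equivariant estimation).** \label{thm:impossibility} Let $\beta$ be weakly regular at $P$ and nontrivial. Then: 1. There is no consistent sequence of estimators of $\beta$. Indeed, no sequence of estimators is consistent along both of two paths in $\mathscr P_{P,\beta}$ whose scores satisfy $\beta_P(g_1)\ne\beta_P(g_2)$. 2. For every $\alpha<1$ and every nontrivial testing problem there is no consistent sequence of tests of level $\alpha$. Indeed, for no two paths in $\mathscr P_{P,\beta}$ is there a sequence of tests with $\limsup_n E^*\phi_n\le\alpha$ along the first and $\phi_n\to1$ in outer probability along the second. 3. There is no sequence of estimators of $\beta$ that is equivariant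 in law with a separable limit law. -/

import Mathlib

open MeasureTheory Filter Topology
open scoped ENNReal BoundedContinuousFunction

namespace WeakId

noncomputable section

/-- A path of probability distributions `Q_t`, indexed by `t ∈ (0, 1]`. -/
abbrev Path (X : Type*) [MeasurableSpace X] : Type _ :=
  Set.Ioc (0 : ℝ) 1 → ProbabilityMeasure X

/-- The filter `t → 0` on the index set `(0, 1]`. -/
def toZero : Filter (Set.Ioc (0 : ℝ) 1) := comap Subtype.val (𝓝 0)

/-- The index `t = 1 / √n` (for `n = 0`, which is irrelevant for limits, it is `1`). -/
def rootIndex (n : ℕ) : Set.Ioc (0 : ℝ) 1 :=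
  ⟨1 / √(max (n : ℝ) 1), by
    have h : (1 : ℝ) ≤ √(max (n : ℝ) 1) := Real.one_le_sqrt.mpr (le_max_right _ _)
    exact ⟨by positivity, (div_le_one (by linarith)).mpr h⟩⟩

/-- The path `t ↦ Q_{a t}`, continued by the constant `Q_1` once `a t ≥ 1`. -/
def Path.rescale {X : Type*} [MeasurableSpace X] (Q : Path X) (a : ℝ) (ha : 0 < a) : Path X :=
  fun t => Q ⟨min (a * t.1) 1, lt_min (mul_pos ha t.2.1) one_pos, min_le_right _ _⟩

/-- `∫ [(dQ^{1/2} - dP^{1/2}) / t - (1/2) g dP^{1/2}]²`. The integral does not depend on the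
dominating measure; the measure `P + Q` is used. -/
def dqmError {X : Type*} [MeasurableSpace X] (P Q : Measure X) (g : X → ℝ) (t : ℝ) : ℝ≥0∞ :=
  ∫⁻ x, ENNReal.ofReal
    (((√(Q.rnDeriv (P + Q) x).toReal - √(P.rnDeriv (P + Q) x).toReal) / t
      - 1 / 2 * g x * √(P.rnDeriv (P + Q) x).toReal) ^ 2) ∂(P + Q)

/-- The path `Q` tends to `P` in quadratic mean with score `g` (a class in `L₂(P)`; a score is
automatically square integrable, and unique as such a class). -/
def HasScore {X : Type*} [MeasurableSpace X] (P : ProbabilityMeasure X) (Q : Path X)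
    (g : Lp ℝ 2 (P : Measure X)) : Prop :=
  Tendsto (fun t => dqmError (P : Measure X) (Q t : Measure X) g t.1) toZero (𝓝 0)

/-- `𝒮` is a set of paths in the model `M` that tend to `P` in quadratic mean. Together with a path
it contains, for each `a > 0`, the same path with index scaled by `a`; as `Q_{a t}` need not be
defined for large `t`, this means a path that is `Q_{a t}` for small `t` and consists of
values of `Q`. -/
structure IsPathFamily {X : Type*} [MeasurableSpace X] (M : Set (ProbabilityMeasure X))
    (P : ProbabilityMeasure X) (𝒮 : Set (Path X)) : Prop where
  mem_model : ∀ Q ∈ 𝒮, ∀ t, Q t ∈ M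
  exists_score : ∀ Q ∈ 𝒮, ∃ g, HasScore P Q g
  rescale : ∀ Q ∈ 𝒮, ∀ (a : ℝ) (ha : 0 < a), ∃ Q' ∈ 𝒮,
    (∀ t, ∃ s, Q' t = Q s) ∧ ∀ᶠ t in toZero, Q' t = Q.rescale a ha t

/-- The tangent set: the scores induced by the paths in `𝒮`. -/
def tangentSet {X : Type*} [MeasurableSpace X] (P : ProbabilityMeasure X) (𝒮 : Set (Path X)) :
    Set (Lp ℝ 2 (P : Measure X)) :=
  {g | ∃ Q ∈ 𝒮, HasScore P Q g}

/-- The tangent set pertinent to the submodel `Mβ`: the scores induced by at least one path of `𝒮`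
with values in `Mβ` and such that `β (Q_t)` has one and the same limit for all these paths. -/
def pertinentTangentSet {X B : Type*} [MeasurableSpace X] [TopologicalSpace B]
    (P : ProbabilityMeasure X) (𝒮 : Set (Path X)) (Mβ : Set (ProbabilityMeasure X))
    (β : ProbabilityMeasure X → B) : Set (Lp ℝ 2 (P : Measure X)) :=
  {g | g ∈ tangentSet P 𝒮 ∧ (∃ Q ∈ 𝒮, (∀ t, Q t ∈ Mβ) ∧ HasScore P Q g) ∧
    ∃ b : B, ∀ Q ∈ 𝒮, (∀ t, Q t ∈ Mβ) → HasScore P Q g →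
      Tendsto (fun t => β (Q t)) toZero (𝓝 b)}

/-- The paths of `𝒮` that take values in `Mβ` and induce a score in the pertinent tangent set. -/
def pertinentPaths {X B : Type*} [MeasurableSpace X] [TopologicalSpace B]
    (P : ProbabilityMeasure X) (𝒮 : Set (Path X)) (Mβ : Set (ProbabilityMeasure X))
    (β : ProbabilityMeasure X → B) : Set (Path X) :=
  {Q | Q ∈ 𝒮 ∧ (∀ t, Q t ∈ Mβ) ∧ ∃ g ∈ pertinentTangentSet P 𝒮 Mβ β, HasScore P Q g}

/-- The parameter `β` on `Mβ` is weakly regular at `P` relative to its pertinent paths, with local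
map `βP`. Only the values of `β` on `Mβ` and those of `βP` on the pertinent tangent set matter. -/
structure IsWeaklyRegular {X B : Type*} [MeasurableSpace X] [TopologicalSpace B]
    (P : ProbabilityMeasure X) (𝒮 : Set (Path X)) (Mβ : Set (ProbabilityMeasure X))
    (β : ProbabilityMeasure X → B) (βP : Lp ℝ 2 (P : Measure X) → B) : Prop where
  continuousOn : ContinuousOn βP (pertinentTangentSet P 𝒮 Mβ β)
  homogeneous : ∀ g ∈ pertinentTangentSet P 𝒮 Mβ β, ∀ a : ℝ, 0 < a →
    a • g ∈ pertinentTangentSet P 𝒮 Mβ β → βP (a • g) = βP g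
  tendsto : ∀ Q ∈ pertinentPaths P 𝒮 Mβ β, ∀ g, HasScore P Q g →
    Tendsto (fun t => β (Q t)) toZero (𝓝 (βP g))

/-- The law `Q_n^n` of an i.i.d. sample of size `n` from `Q_n = Q_{1/√n}`. -/
def sampleLaw {X : Type*} [MeasurableSpace X] (Q : Path X) (n : ℕ) : Measure (Fin n → X) :=
  Measure.pi fun _ => (Q (rootIndex n) : Measure X)

/-- Outer expectation of a bounded, not necessarily measurable function. -/
def outerExp {Ω : Type*} [MeasurableSpace Ω] (μ : Measure Ω) (f : Ω → ℝ) : ℝ :=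
  sInf {r | ∃ U : Ω → ℝ, Measurable U ∧ Integrable U μ ∧ (∀ ω, f ω ≤ U ω) ∧ r = ∫ ω, U ω ∂μ}

/-- `Z_n → 0` in outer probability under `μ_n`, for not necessarily measurable real functions.
The measure of a non-measurable set is its outer measure. -/
def TendstoZeroInOuterProb {Ω : ℕ → Type*} [∀ n, MeasurableSpace (Ω n)]
    (μ : ∀ n, Measure (Ω n)) (Z : ∀ n, Ω n → ℝ) : Prop :=
  ∀ ε : ℝ, 0 < ε → Tendsto (fun n => μ n {ω | ε < |Z n ω|}) atTop (𝓝 0)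

/-- Weak convergence of not necessarily measurable maps `Y_n`, under `μ_n`, to a Borel law `L`:
the outer expectations of bounded continuous functions converge. -/
def WeaklyConvergesTo {B : Type*} [TopologicalSpace B] [MeasurableSpace B]
    {Ω : ℕ → Type*} [∀ n, MeasurableSpace (Ω n)]
    (μ : ∀ n, Measure (Ω n)) (Y : ∀ n, Ω n → B) (L : Measure B) : Prop :=
  ∀ f : B →ᵇ ℝ, Tendsto (fun n => outerExp (μ n) fun ω => f (Y n ω)) atTop (𝓝 (∫ b, f b ∂L))

/-- A sequence of estimators: for each sample size `n` any map from samples to `B`. -/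
abbrev Estimators (X B : Type*) : Type _ := ∀ n : ℕ, (Fin n → X) → B

/-- A sequence of (randomized) tests: for each `n` any map from samples to `[0, 1]`. -/
abbrev Tests (X : Type*) : Type _ := ∀ n : ℕ, (Fin n → X) → Set.Icc (0 : ℝ) 1

/-- The estimation error tends to zero in outer probability along the path `Q`. -/
def ConsistentAlong {X B : Type*} [MeasurableSpace X] [NormedAddCommGroup B]
    (β : ProbabilityMeasure X → B) (est : Estimators X B) (Q : Path X) : Prop :=
  TendstoZeroInOuterProb (sampleLaw Q) fun n x => ‖est n x - β (Q (rootIndex n))‖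

/-- Consistency: along every pertinent path. -/
def IsConsistent {X B : Type*} [MeasurableSpace X] [NormedAddCommGroup B]
    (P : ProbabilityMeasure X) (𝒮 : Set (Path X)) (Mβ : Set (ProbabilityMeasure X))
    (β : ProbabilityMeasure X → B) (est : Estimators X B) : Prop :=
  ∀ Q ∈ pertinentPaths P 𝒮 Mβ β, ConsistentAlong β est Q

/-- The tests have asymptotic rejection probability at most `α` along the path `Q`. -/
def LevelAlong {X : Type*} [MeasurableSpace X] (φ : Tests X) (α : ℝ) (Q : Path X) : Prop :=
  limsup (fun n => outerExp (sampleLaw Q n) fun x => (φ n x : ℝ)) atTop ≤ α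

/-- The tests tend to one in outer probability along the path `Q`. -/
def PowerOneAlong {X : Type*} [MeasurableSpace X] (φ : Tests X) (Q : Path X) : Prop :=
  TendstoZeroInOuterProb (sampleLaw Q) fun n x => 1 - (φ n x : ℝ)

/-- The tests `φ` of `H₀ : β ∈ B₀` against `H₁ : β ∈ B₁` have asymptotic level `α` along every
pertinent path with limit of `β` in `B₀`, and tend to one along every pertinent path with limit
of `β` in `B₁`. -/
structure IsConsistentTest {X B : Type*} [MeasurableSpace X] [TopologicalSpace B]
    (P : ProbabilityMeasure X) (𝒮 : Set (Path X)) (Mβ : Set (ProbabilityMeasure X))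
    (β : ProbabilityMeasure X → B) (βP : Lp ℝ 2 (P : Measure X) → B)
    (B₀ B₁ : Set B) (α : ℝ) (φ : Tests X) : Prop where
  level : ∀ Q ∈ pertinentPaths P 𝒮 Mβ β, ∀ g, HasScore P Q g → βP g ∈ B₀ → LevelAlong φ α Q
  power : ∀ Q ∈ pertinentPaths P 𝒮 Mβ β, ∀ g, HasScore P Q g → βP g ∈ B₁ → PowerOneAlong φ Q

/-- A testing problem is nontrivial if both hypotheses contain a limiting value of `β`. -/
def NontrivialTesting {X B : Type*} [MeasurableSpace X] [TopologicalSpace B]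
    (P : ProbabilityMeasure X) (𝒮 : Set (Path X)) (Mβ : Set (ProbabilityMeasure X))
    (β : ProbabilityMeasure X → B) (βP : Lp ℝ 2 (P : Measure X) → B) (B₀ B₁ : Set B) : Prop :=
  (∃ g ∈ pertinentTangentSet P 𝒮 Mβ β, βP g ∈ B₀) ∧
    ∃ g ∈ pertinentTangentSet P 𝒮 Mβ β, βP g ∈ B₁

/-- Equivariance in law with limit law `L`: `est_n - β(Q_n)` converges weakly to the same `L` under
`Q_n^n` along every pertinent path. -/
def IsEquivariantInLaw {X B : Type*} [MeasurableSpace X] [NormedAddCommGroup B]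
    [MeasurableSpace B] (P : ProbabilityMeasure X) (𝒮 : Set (Path X))
    (Mβ : Set (ProbabilityMeasure X)) (β : ProbabilityMeasure X → B)
    (est : Estimators X B) (L : Measure B) : Prop :=
  ∀ Q ∈ pertinentPaths P 𝒮 Mβ β,
    WeaklyConvergesTo (sampleLaw Q) (fun n x => est n x - β (Q (rootIndex n))) L

/-- The law `L` is concentrated on a separable measurable set. -/
def IsSeparableLaw {B : Type*} [TopologicalSpace B] [MeasurableSpace B] (L : Measure B) : Prop :=
  ∃ S : Set B, MeasurableSet S ∧ TopologicalSpace.IsSeparable S ∧ L Sᶜ = 0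

end

end WeakId

/-! ### Product measures compared through a bounded likelihood ratio -/

namespace WeakId

/-! Along two paths with scores g₁ and g₂ the laws of one observation are at squared Hellinger
distance O(1/n), so the laws of n observations never separate: events whose probability tends to
zero along one path have probability tending to zero along the other (`tendsto_sampleLaw_zero`).
Consistent tests, or estimators consistent for distinct limits, would produce separating events;
hence `not_levelAlong_of_powerOneAlong` and `not_consistentAlong`.

For equivariance, both scores are multiplied by a small a > 0. By homogeneity the limits of the
parameter stay the same, whereas the sample laws become close in total variation
(`exists_integral_sampleLaw_le`). Hence the translates of the limit law by βP g₁ and βP g₂ agree on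
the functions cos(sℓ + c) (`integral_cosTest_le`), and no probability law is invariant under a
translation that ℓ detects (`not_forall_integral_cos_eq`).

Both comparisons of sample laws use the likelihood ratio r truncated to the set B where the density
of Q₁ is at most four times that of Q₂. By `exists_boundedRatio`, Q₁(Bᶜ) = o(1/n) and ∫ r² dQ₂ ≤ 1 +
O(1/n). The product D of the r(xᵢ) then has bounded second moment, which gives contiguity, and E(D −
1)² is asymptotically at most exp(9‖g₁ − g₂‖²) − 1, which gives the total variation bound. -/

/-- The product of measures with bounded densities has the product density. -/
lemma pi_withDensity_ofReal {X ι : Type*} [MeasurableSpace X] [Fintype ι] {Q : Measure X}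
    [IsProbabilityMeasure Q] {r : X → ℝ} (hr : Measurable r) (hr0 : ∀ x, 0 ≤ r x) {c : ℝ}
    (hrc : ∀ x, r x ≤ c) :
    Measure.pi (fun _ : ι => Q.withDensity fun x => ENNReal.ofReal (r x)) =
      (Measure.pi fun _ : ι => Q).withDensity fun x => ENNReal.ofReal (∏ i, r (x i)) := by
  have hint (s : Set X) : Integrable r (Q.restrict s) :=
    .of_bound hr.aestronglyMeasurable c (.of_forall fun x => by
      rw [Real.norm_of_nonneg (hr0 x)]; exact hrc x)
  have hfin : IsFiniteMeasure (Q.withDensity fun x => ENNReal.ofReal (r x)) := by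
    have := hint Set.univ
    rw [Measure.restrict_univ] at this
    exact isFiniteMeasure_withDensity_ofReal this.2
  -- Rectangles suffice. Boundedness of `r` permits Bochner integrals, and these factor over the
  -- coordinates.
  refine Measure.pi_eq fun s hs => ?_
  rw [withDensity_apply _ (MeasurableSet.univ_pi hs), Measure.restrict_pi_pi,
    ← ofReal_integral_eq_lintegral_ofReal, integral_fintype_prod_eq_prod]
  · rw [ENNReal.ofReal_prod_of_nonneg fun i _ => integral_nonneg hr0]
    refine Finset.prod_congr rfl fun i _ => ?_
    rw [withDensity_apply _ (hs i), ← ofReal_integral_eq_lintegral_ofReal (hint _)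
      (.of_forall hr0)]
  · exact Integrable.fintype_prod fun i => hint _
  · exact .of_forall fun x => Finset.prod_nonneg fun i _ => hr0 _

/-- `Q₁` has density `r ∈ [0, 4]` relative to `Q₂` on the set `B`. -/
structure BoundedRatio {X : Type*} [MeasurableSpace X] (Q₁ Q₂ : Measure X) (B : Set X)
    (r : X → ℝ) : Prop where
  measurableSet : MeasurableSet B
  measurable : Measurable r
  nonneg : ∀ x, 0 ≤ r x
  le_four : ∀ x, r x ≤ 4
  restrict_eq : Q₁.restrict B = Q₂.withDensity fun x => ENNReal.ofReal (r x)

section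

variable {X : Type*} [MeasurableSpace X] {Q₁ Q₂ : Measure X} {B : Set X} {r : X → ℝ}

lemma BoundedRatio.measurable_prod (h : BoundedRatio Q₁ Q₂ B r) (n : ℕ) :
    Measurable fun x : Fin n → X => ∏ i, r (x i) :=
  Finset.measurable_prod _ fun i _ => h.measurable.comp (measurable_pi_apply i)

lemma BoundedRatio.prod_nonneg (h : BoundedRatio Q₁ Q₂ B r) (n : ℕ) (x : Fin n → X) :
    0 ≤ ∏ i, r (x i) := Finset.prod_nonneg fun _ _ => h.nonneg _

lemma BoundedRatio.prod_le (h : BoundedRatio Q₁ Q₂ B r) (n : ℕ) (x : Fin n → X) :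
    ∏ i, r (x i) ≤ 4 ^ n := by
  simpa using Finset.prod_le_prod (fun i _ => h.nonneg (x i))
    fun i (_ : i ∈ Finset.univ) => h.le_four (x i)

lemma BoundedRatio.one_sub_le_real_pi [IsProbabilityMeasure Q₁] (h : BoundedRatio Q₁ Q₂ B r) (n : ℕ) :
    1 - n * Q₁.real Bᶜ ≤ (Measure.pi fun _ : Fin n => Q₁).real (Set.univ.pi fun _ => B) := by
  rw [measureReal_def (μ := Measure.pi _), Measure.pi_pi]
  have h1 : Q₁.real B = 1 + -Q₁.real Bᶜ := by
    rw [probReal_compl_eq_one_sub h.measurableSet]; ring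
  -- Bernoulli's inequality.
  have h2 := one_add_mul_le_pow (a := -Q₁.real Bᶜ)
    (by linarith [measureReal_le_one (μ := Q₁) (s := Bᶜ)]) n
  rw [← h1] at h2
  simp only [Finset.prod_const, Finset.card_univ, Fintype.card_fin, ENNReal.toReal_pow]
  change _ ≤ Q₁.real B ^ n
  linarith

variable [IsProbabilityMeasure Q₂]

lemma integral_prod_sq_le {r : X → ℝ} (n : ℕ) {c : ℝ} (hc : ∫ x, r x ^ 2 ∂Q₂ ≤ 1 + c) :
    ∫ x : Fin n → X, (∏ i, r (x i)) ^ 2 ∂(Measure.pi fun _ => Q₂) ≤ Real.exp (n * c) := by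
  simp only [← Finset.prod_pow]
  rw [integral_fintype_prod_eq_pow (fun x => r x ^ 2), Fintype.card_fin, Real.exp_nat_mul]
  exact pow_le_pow_left₀ (integral_nonneg fun x => sq_nonneg _)
    (hc.trans (by linarith [Real.add_one_le_exp c])) n

lemma BoundedRatio.integrable_prod (h : BoundedRatio Q₁ Q₂ B r) (n : ℕ) :
    Integrable (fun x : Fin n → X => ∏ i, r (x i)) (Measure.pi fun _ => Q₂) :=
  .of_bound (h.measurable_prod n).aestronglyMeasurable (4 ^ n) (.of_forall fun x => by
    rw [Real.norm_of_nonneg (h.prod_nonneg n x)]; exact h.prod_le n x)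

lemma BoundedRatio.integrable_prod_sq (h : BoundedRatio Q₁ Q₂ B r) (n : ℕ) :
    Integrable (fun x : Fin n → X => (∏ i, r (x i)) ^ 2) (Measure.pi fun _ => Q₂) :=
  .of_bound ((h.measurable_prod n).pow_const 2).aestronglyMeasurable ((4 ^ n) ^ 2)
    (.of_forall fun x => by
      rw [Real.norm_of_nonneg (sq_nonneg _)]
      exact pow_le_pow_left₀ (h.prod_nonneg n x) (h.prod_le n x) 2)

variable [IsProbabilityMeasure Q₁]

lemma BoundedRatio.restrict_pi_eq (h : BoundedRatio Q₁ Q₂ B r) (n : ℕ) :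
    (Measure.pi fun _ : Fin n => Q₁).restrict (Set.univ.pi fun _ => B) =
      (Measure.pi fun _ => Q₂).withDensity fun x => ENNReal.ofReal (∏ i, r (x i)) := by
  rw [Measure.restrict_pi_pi, h.restrict_eq,
    pi_withDensity_ofReal h.measurable h.nonneg h.le_four]

lemma BoundedRatio.one_sub_le_integral_prod (h : BoundedRatio Q₁ Q₂ B r) (n : ℕ) :
    1 - n * Q₁.real Bᶜ ≤ ∫ x : Fin n → X, ∏ i, r (x i) ∂(Measure.pi fun _ => Q₂) := by
  refine (h.one_sub_le_real_pi n).trans_eq ?_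
  rw [measureReal_def, ← Measure.restrict_apply_univ, h.restrict_pi_eq,
    withDensity_apply _ .univ, Measure.restrict_univ, integral_eq_lintegral_of_nonneg_ae
    (.of_forall (h.prod_nonneg n)) (h.measurable_prod n).aestronglyMeasurable]

/-- Integrals under the product of `Q₁` are nearly integrals of the truncated likelihood ratio. -/
lemma BoundedRatio.integral_pi_le (h : BoundedRatio Q₁ Q₂ B r) (n : ℕ) {U : (Fin n → X) → ℝ}
    (hU : Measurable U) (hU0 : ∀ x, 0 ≤ U x) (hU1 : ∀ x, U x ≤ 1) :
    ∫ x, U x ∂(Measure.pi fun _ => Q₁) ≤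
      n * Q₁.real Bᶜ + ∫ x, (∏ i, r (x i)) * U x ∂(Measure.pi fun _ => Q₂) := by
  have hB : MeasurableSet (Set.univ.pi fun _ : Fin n => B) := .univ_pi fun _ => h.measurableSet
  have hint : Integrable U (Measure.pi fun _ => Q₁) :=
    .of_bound hU.aestronglyMeasurable 1 (.of_forall fun x => by
      rw [Real.norm_of_nonneg (hU0 x)]; exact hU1 x)
  rw [← integral_add_compl hB hint, h.restrict_pi_eq, integral_withDensity_eq_integral_toReal_smul
    (h.measurable_prod n).ennreal_ofReal (.of_forall fun x => ENNReal.ofReal_lt_top)]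
  have h1 : ∫ x in (Set.univ.pi fun _ : Fin n => B)ᶜ, U x ∂(Measure.pi fun _ => Q₁) ≤
      n * Q₁.real Bᶜ := by
    calc _ ≤ ∫ x in (Set.univ.pi fun _ : Fin n => B)ᶜ, (1 : ℝ) ∂(Measure.pi fun _ => Q₁) :=
          integral_mono hint.integrableOn (integrable_const _) hU1
      _ = 1 - (Measure.pi fun _ : Fin n => Q₁).real (Set.univ.pi fun _ => B) := by
          rw [setIntegral_const, probReal_compl_eq_one_sub hB, smul_eq_mul, mul_one]
      _ ≤ _ := by linarith [h.one_sub_le_real_pi n]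
  have h2 (x : Fin n → X) : (ENNReal.ofReal (∏ i, r (x i))).toReal • U x
      = (∏ i, r (x i)) * U x := by
    rw [ENNReal.toReal_ofReal (h.prod_nonneg n x), smul_eq_mul]
  simp only [h2]
  linarith

/-- A quantitative form of contiguity of the product of `Q₁` relative to the product of `Q₂`. -/
lemma BoundedRatio.integral_pi_le_contiguous (h : BoundedRatio Q₁ Q₂ B r) (n : ℕ)
    {U : (Fin n → X) → ℝ} (hU : Measurable U) (hU0 : ∀ x, 0 ≤ U x) (hU1 : ∀ x, U x ≤ 1) {c : ℝ}
    (hc : ∫ x, r x ^ 2 ∂Q₂ ≤ 1 + c) {l : ℝ} (hl : 0 < l) :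
    ∫ x, U x ∂(Measure.pi fun _ => Q₁) ≤
      n * Q₁.real Bᶜ + l * ∫ x, U x ∂(Measure.pi fun _ => Q₂) + Real.exp (n * c) / l := by
  have hUi : Integrable U (Measure.pi fun _ => Q₂) :=
    .of_bound hU.aestronglyMeasurable 1 (.of_forall fun x => by
      rw [Real.norm_of_nonneg (hU0 x)]; exact hU1 x)
  have key : ∫ x, (∏ i, r (x i)) * U x ∂(Measure.pi fun _ => Q₂) ≤
      ∫ x, (l * U x + (∏ i, r (x i)) ^ 2 / l) ∂(Measure.pi fun _ => Q₂) := by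
    refine integral_mono_of_nonneg
      (.of_forall fun x => mul_nonneg (h.prod_nonneg n x) (hU0 x))
      ((hUi.const_mul l).add ((h.integrable_prod_sq n).div_const l)) (.of_forall fun x => ?_)
    set D := ∏ i, r (x i)
    have hD : 0 ≤ D := h.prod_nonneg n x
    -- Young's inequality: `l` trades the size of the test function against the second moment of the
    -- likelihood ratio.
    have h1 : D * U x ≤ l * U x ^ 2 + D ^ 2 / l := by
      rw [← sub_nonneg]
      have : l * U x ^ 2 + D ^ 2 / l - D * U x
          = ((l * U x - D) ^ 2 + l * (D * U x)) / l := by field_simp; ring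
      rw [this]
      have := mul_nonneg hD (hU0 x)
      positivity
    have h2 : U x ^ 2 ≤ U x := by nlinarith [hU0 x, hU1 x]
    show D * U x ≤ l * U x + D ^ 2 / l
    nlinarith
  rw [integral_add (hUi.const_mul l) ((h.integrable_prod_sq n).div_const l),
    integral_const_mul, integral_div] at key
  have := div_le_div_of_nonneg_right (integral_prod_sq_le n hc) hl.le
  linarith [h.integral_pi_le n hU hU0 hU1]

/-- A bound on the total variation distance between the products of `Q₁` and of `Q₂`. -/
lemma BoundedRatio.integral_pi_le_add (h : BoundedRatio Q₁ Q₂ B r) (n : ℕ)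
    {U : (Fin n → X) → ℝ} (hU : Measurable U) (hU0 : ∀ x, 0 ≤ U x) (hU1 : ∀ x, U x ≤ 1) {c : ℝ}
    (hc : ∫ x, r x ^ 2 ∂Q₂ ≤ 1 + c) {l : ℝ} (hl : 0 < l) :
    ∫ x, U x ∂(Measure.pi fun _ => Q₁) ≤ (∫ x, U x ∂(Measure.pi fun _ => Q₂)) +
      (n * Q₁.real Bᶜ + l + (Real.exp (n * c) - 1 + 2 * (n * Q₁.real Bᶜ)) / l) := by
  have hUi : Integrable U (Measure.pi fun _ => Q₂) :=
    .of_bound hU.aestronglyMeasurable 1 (.of_forall fun x => by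
      rw [Real.norm_of_nonneg (hU0 x)]; exact hU1 x)
  have hDi := h.integrable_prod n
  have hD2 := h.integrable_prod_sq n
  have hUl : Integrable (fun x => U x + l) (Measure.pi fun _ => Q₂) :=
    hUi.add (integrable_const l)
  have hi0 : Integrable (fun x : Fin n → X => (∏ i, r (x i)) ^ 2 - 2 * ∏ i, r (x i))
      (Measure.pi fun _ => Q₂) := hD2.sub (hDi.const_mul 2)
  have hi : Integrable (fun x : Fin n → X => ((∏ i, r (x i)) ^ 2 - 2 * ∏ i, r (x i)) + 1)
      (Measure.pi fun _ => Q₂) := hi0.add (integrable_const 1)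
  have key : ∫ x, (∏ i, r (x i)) * U x ∂(Measure.pi fun _ => Q₂) ≤
      ∫ x, ((U x + l) + (((∏ i, r (x i)) ^ 2 - 2 * ∏ i, r (x i)) + 1) / l)
        ∂(Measure.pi fun _ => Q₂) := by
    refine integral_mono_of_nonneg
      (.of_forall fun x => mul_nonneg (h.prod_nonneg n x) (hU0 x))
      (hUl.add (hi.div_const l)) (.of_forall fun x => ?_)
    set D := ∏ i, r (x i)
    -- Again Young's inequality, now around the value 1, near which `D` concentrates when the two
    -- laws are close.
    have h1 : |D - 1| ≤ l + (D - 1) ^ 2 / l := by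
      rw [← sub_nonneg, ← sq_abs (D - 1)]
      have : l + |D - 1| ^ 2 / l - |D - 1| = ((l - |D - 1|) ^ 2 + l * |D - 1|) / l := by
        field_simp; ring
      rw [this]
      positivity
    have h2 : (D - 1) * U x ≤ |D - 1| :=
      calc (D - 1) * U x ≤ |D - 1| * U x :=
            mul_le_mul_of_nonneg_right (le_abs_self _) (hU0 x)
        _ ≤ |D - 1| * 1 := mul_le_mul_of_nonneg_left (hU1 x) (abs_nonneg _)
        _ = _ := mul_one _
    have h3 : (D ^ 2 - 2 * D) + 1 = (D - 1) ^ 2 := by ring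
    show D * U x ≤ (U x + l) + ((D ^ 2 - 2 * D) + 1) / l
    rw [h3]
    linarith
  rw [integral_add hUl (hi.div_const l), integral_div,
    integral_add hUi (integrable_const l),
    integral_add hi0 (integrable_const 1),
    integral_sub hD2 (hDi.const_mul 2), integral_const_mul] at key
  simp only [integral_const, probReal_univ, smul_eq_mul, one_mul] at key
  -- E(D − 1)² = E D² − 2 E D + 1 is bounded from an upper bound on E D² and a lower bound on E D.
  have h4 := integral_prod_sq_le n hc
  have h5 := h.one_sub_le_integral_prod n
  have h6 := div_le_div_of_nonneg_right
    (c := l) (show _ ≤ Real.exp (n * c) - 1 + 2 * (n * Q₁.real Bᶜ) by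
      linarith : (∫ x : Fin n → X, (∏ i, r (x i)) ^ 2 ∂(Measure.pi fun _ => Q₂)) -
      2 * (∫ x : Fin n → X, ∏ i, r (x i) ∂(Measure.pi fun _ => Q₂)) + 1 ≤ _) hl.le
  linarith [h.integral_pi_le n hU hU0 hU1]

end
end WeakId

/-! ### Root densities, quadratic mean errors and Hellinger integrals -/

namespace WeakId

noncomputable section

variable {X : Type*} [MeasurableSpace X]

/-- The root of the density of `Q` relative to `μ`. -/
def rootDensity (μ Q : Measure X) (x : X) : ℝ := √(Q.rnDeriv μ x).toReal

lemma measurable_rootDensity (μ Q : Measure X) : Measurable (rootDensity μ Q) :=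
  (Measure.measurable_rnDeriv _ _).ennreal_toReal.sqrt

lemma rootDensity_nonneg (μ Q : Measure X) (x : X) : 0 ≤ rootDensity μ Q x := Real.sqrt_nonneg _

lemma ofReal_rootDensity_sq (μ Q : Measure X) [SigmaFinite Q] :
    ∀ᵐ x ∂μ, ENNReal.ofReal (rootDensity μ Q x ^ 2) = Q.rnDeriv μ x := by
  filter_upwards [Q.rnDeriv_ne_top μ] with x hx
  rw [rootDensity, Real.sq_sqrt ENNReal.toReal_nonneg, ENNReal.ofReal_toReal hx]

lemma lintegral_rootDensity_sq_mul {μ Q : Measure X} [SigmaFinite μ] [SigmaFinite Q] (h : Q ≪ μ)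
    {f : X → ℝ≥0∞} (hf : Measurable f) :
    ∫⁻ x, ENNReal.ofReal (rootDensity μ Q x ^ 2) * f x ∂μ = ∫⁻ x, f x ∂Q := by
  rw [← lintegral_rnDeriv_mul h hf.aemeasurable]
  refine lintegral_congr_ae ?_
  filter_upwards [ofReal_rootDensity_sq μ Q] with x hx
  rw [hx]

lemma lintegral_rootDensity_sq {μ Q : Measure X} [SigmaFinite μ] [SigmaFinite Q] (h : Q ≪ μ) :
    ∫⁻ x, ENNReal.ofReal (rootDensity μ Q x ^ 2) ∂μ = Q Set.univ := by
  simpa using lintegral_rootDensity_sq_mul h (f := fun _ => 1) measurable_const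

lemma setLIntegral_rootDensity_sq {μ Q : Measure X} [SigmaFinite μ] [SigmaFinite Q] (h : Q ≪ μ)
    {S : Set X} (hS : MeasurableSet S) :
    ∫⁻ x in S, ENNReal.ofReal (rootDensity μ Q x ^ 2) ∂μ = Q S := by
  have := lintegral_rootDensity_sq_mul h (f := S.indicator 1) (measurable_one.indicator hS)
  rw [lintegral_indicator_one hS] at this
  rw [← this, ← lintegral_indicator hS]
  refine lintegral_congr fun x => ?_
  by_cases hx : x ∈ S <;> simp [hx]

/-- The quadratic mean error does not depend on the dominating measure. -/
lemma dqmError_eq_lintegral {μ P Q : Measure X} [IsFiniteMeasure P] [IsFiniteMeasure Q]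
    [SigmaFinite μ] (hP : P ≪ μ) (hQ : Q ≪ μ) {g : X → ℝ} (hg : Measurable g) (t : ℝ) :
    dqmError P Q g t = ∫⁻ x, ENNReal.ofReal (((rootDensity μ Q x - rootDensity μ P x) / t
      - 1 / 2 * g x * rootDensity μ P x) ^ 2) ∂μ := by
  set ν := P + Q with hν
  have hPν : P ≪ ν := Measure.AbsolutelyContinuous.rfl.add_right Q
  have hQν : Q ≪ ν := by
    rw [hν, add_comm]; exact Measure.AbsolutelyContinuous.rfl.add_right P
  have hνμ : ν ≪ μ := Measure.AbsolutelyContinuous.add_left hP hQ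
  have hmP := measurable_rootDensity ν P
  have hmQ := measurable_rootDensity ν Q
  have hdef : dqmError P Q g t = ∫⁻ x, ENNReal.ofReal (((rootDensity ν Q x - rootDensity ν P x) / t
      - 1 / 2 * g x * rootDensity ν P x) ^ 2) ∂ν := rfl
  rw [hdef, ← lintegral_rootDensity_sq_mul hνμ (by fun_prop)]
  refine lintegral_congr_ae ?_
  filter_upwards [Measure.rnDeriv_mul_rnDeriv (κ := μ) hPν,
    Measure.rnDeriv_mul_rnDeriv (κ := μ) hQν] with x h1 h2
  -- The integrand is homogeneous of degree two in the pair of roots, so it absorbs the density of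
  -- `ν`.
  have hp : rootDensity μ P x = rootDensity ν P x * rootDensity μ ν x := by
    simp only [rootDensity]
    rw [← h1, Pi.mul_apply, ENNReal.toReal_mul, Real.sqrt_mul ENNReal.toReal_nonneg]
  have hq : rootDensity μ Q x = rootDensity ν Q x * rootDensity μ ν x := by
    simp only [rootDensity]
    rw [← h2, Pi.mul_apply, ENNReal.toReal_mul, Real.sqrt_mul ENNReal.toReal_nonneg]
  rw [hp, hq, ← ENNReal.ofReal_mul (sq_nonneg _)]
  congr 1
  ring

/-- The quadratic mean error depends on the score only up to `P`-null sets. -/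
lemma dqmError_congr {P Q : Measure X} [IsFiniteMeasure P] [IsFiniteMeasure Q] {g g' : X → ℝ}
    (h : g =ᵐ[P] g') (t : ℝ) : dqmError P Q g t = dqmError P Q g' t := by
  refine lintegral_congr_ae ?_
  have hP : P ≪ P + Q := Measure.AbsolutelyContinuous.rfl.add_right Q
  -- Where the density of `P` vanishes, the score is multiplied by zero and its value is immaterial.
  have h' : ∀ᵐ x ∂(P + Q).withDensity (P.rnDeriv (P + Q)), g x = g' x := by
    rw [Measure.withDensity_rnDeriv_eq _ _ hP]; exact h
  rw [ae_withDensity_iff (Measure.measurable_rnDeriv _ _)] at h'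
  filter_upwards [h'] with x hx
  by_cases h0 : P.rnDeriv (P + Q) x = 0
  · simp [h0]
  · rw [hx h0]

/-- The squared Hellinger distance, computed with the dominating measure `μ`. -/
def hellingerSq (μ Q₁ Q₂ : Measure X) : ℝ≥0∞ :=
  ∫⁻ x, ENNReal.ofReal ((rootDensity μ Q₁ x - rootDensity μ Q₂ x) ^ 2) ∂μ

/-- A bound on the local Hellinger integral in terms of errors in quadratic mean. -/
lemma setLIntegral_sub_sq_le {μ P Q₁ Q₂ : Measure X} [IsFiniteMeasure P] [IsFiniteMeasure Q₁]
    [IsFiniteMeasure Q₂] [SigmaFinite μ] (hP : P ≪ μ) (h₁ : Q₁ ≪ μ) (h₂ : Q₂ ≪ μ)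
    {g₁ g₂ : X → ℝ} (hg₁ : Measurable g₁) (hg₂ : Measurable g₂) {t : ℝ} (ht : 0 < t) {S : Set X}
    (hS : MeasurableSet S) :
    ∫⁻ x in S, ENNReal.ofReal ((rootDensity μ Q₁ x - rootDensity μ Q₂ x) ^ 2) ∂μ ≤
      ENNReal.ofReal (t ^ 2) * (4 * (dqmError P Q₁ g₁ t + dqmError P Q₂ g₂ t) +
        ∫⁻ x in S, ENNReal.ofReal ((g₁ x - g₂ x) ^ 2) ∂P) := by
  have hmP := measurable_rootDensity μ P
  have hm₁ := measurable_rootDensity μ Q₁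
  have hm₂ := measurable_rootDensity μ Q₂
  have hG : ∫⁻ x in S, ENNReal.ofReal ((g₁ x - g₂ x) ^ 2) ∂P =
      ∫⁻ x in S, ENNReal.ofReal ((rootDensity μ P x) ^ 2 * (g₁ x - g₂ x) ^ 2) ∂μ := by
    rw [← lintegral_indicator hS, ← lintegral_indicator hS, ← lintegral_rootDensity_sq_mul hP
      (Measurable.indicator (by fun_prop) hS)]
    refine lintegral_congr fun x => ?_
    by_cases hx : x ∈ S <;> simp [hx, ENNReal.ofReal_mul (sq_nonneg _)]
  rw [hG, dqmError_eq_lintegral hP h₁ hg₁, dqmError_eq_lintegral hP h₂ hg₂]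
  refine le_trans ?_ (mul_le_mul_right (add_le_add_left (mul_le_mul_right
    (add_le_add (setLIntegral_le_lintegral S _) (setLIntegral_le_lintegral S _)) _) _) _)
  rw [← lintegral_add_left (by fun_prop), ← lintegral_const_mul _ (by fun_prop),
    ← lintegral_add_left (by fun_prop), ← lintegral_const_mul _ (by fun_prop)]
  refine lintegral_mono fun x => ?_
  simp only
  rw [← ENNReal.ofReal_ofNat 4, ← ENNReal.ofReal_add (sq_nonneg _) (sq_nonneg _),
    ← ENNReal.ofReal_mul (by positivity), ← ENNReal.ofReal_add (by positivity) (by positivity),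
    ← ENNReal.ofReal_mul (by positivity)]
  refine ENNReal.ofReal_le_ofReal ?_
  generalize rootDensity μ P x = p
  generalize rootDensity μ Q₁ x = a
  generalize rootDensity μ Q₂ x = b
  set u := (a - p) / t - 1 / 2 * g₁ x * p with hu
  set v := (b - p) / t - 1 / 2 * g₂ x * p with hv
  -- The root of `P` cancels in the difference; only the two remainders and the difference of the
  -- scores are left.
  have hab : a - b = t * (u - v + 1 / 2 * ((g₁ x - g₂ x) * p)) := by
    rw [hu, hv]; field_simp; ring
  rw [hab, mul_pow]
  refine mul_le_mul_of_nonneg_left ?_ (sq_nonneg _)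
  nlinarith [sq_nonneg (u + v), sq_nonneg (u - v - 1 / 2 * ((g₁ x - g₂ x) * p)),
    sq_nonneg ((g₁ x - g₂ x) * p)]

lemma dqmError_self {P : Measure X} (t : ℝ) : dqmError P P (fun _ => 0) t = 0 := by
  simp [dqmError]

/-- The comparison of two laws is applied with `P` itself as the second one, which has score zero
and no error. -/
lemma hellingerSq_le {μ P Q : Measure X} [IsFiniteMeasure P] [IsFiniteMeasure Q]
    [SigmaFinite μ] (hP : P ≪ μ) (hQ : Q ≪ μ) {g : X → ℝ} (hg : Measurable g) {t : ℝ}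
    (ht : 0 < t) :
    hellingerSq μ Q P ≤ ENNReal.ofReal (t ^ 2) * (4 * dqmError P Q g t +
        ∫⁻ x, ENNReal.ofReal (g x ^ 2) ∂P) := by
  have := setLIntegral_sub_sq_le hP hQ hP hg (measurable_const (a := (0 : ℝ))) ht .univ
  simpa [dqmError_self, hellingerSq] using this

/-! ### The truncated likelihood ratio -/

/-- The set where the density of `Q₁` is at most four times that of `Q₂`. -/
def ratioSet (μ Q₁ Q₂ : Measure X) : Set X := {x | rootDensity μ Q₁ x ≤ 2 * rootDensity μ Q₂ x}

lemma measurableSet_ratioSet (μ Q₁ Q₂ : Measure X) : MeasurableSet (ratioSet μ Q₁ Q₂) :=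
  measurableSet_le (measurable_rootDensity _ _) ((measurable_rootDensity _ _).const_mul 2)

/-- The ratio of densities, truncated to `ratioSet`. -/
def truncatedRatio (μ Q₁ Q₂ : Measure X) : X → ℝ :=
  (ratioSet μ Q₁ Q₂).indicator fun x => (rootDensity μ Q₁ x / rootDensity μ Q₂ x) ^ 2

lemma measurable_truncatedRatio (μ Q₁ Q₂ : Measure X) : Measurable (truncatedRatio μ Q₁ Q₂) :=
  (((measurable_rootDensity _ _).div (measurable_rootDensity _ _)).pow_const 2).indicator
    (measurableSet_ratioSet _ _ _)

lemma truncatedRatio_nonneg (μ Q₁ Q₂ : Measure X) (x : X) : 0 ≤ truncatedRatio μ Q₁ Q₂ x :=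
  Set.indicator_nonneg (fun _ _ => sq_nonneg _) x

lemma truncatedRatio_le (μ Q₁ Q₂ : Measure X) (x : X) : truncatedRatio μ Q₁ Q₂ x ≤ 4 := by
  refine Set.indicator_le' (f := fun x => (rootDensity μ Q₁ x / rootDensity μ Q₂ x) ^ 2)
    (g := fun _ => 4) (fun x hx => ?_) (fun _ _ => by norm_num) x
  have h0 := div_nonneg (rootDensity_nonneg μ Q₁ x) (rootDensity_nonneg μ Q₂ x)
  have h2 := div_le_of_le_mul₀ (rootDensity_nonneg μ Q₂ x) zero_le_two hx
  nlinarith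

/-- Inside the set a zero of the second root is also a zero of the first, so the convention for
division by zero does no harm. -/
lemma rootDensity_sq_mul_truncatedRatio (μ Q₁ Q₂ : Measure X) {x : X}
    (hx : x ∈ ratioSet μ Q₁ Q₂) :
    rootDensity μ Q₂ x ^ 2 * truncatedRatio μ Q₁ Q₂ x = rootDensity μ Q₁ x ^ 2 := by
  rw [truncatedRatio, Set.indicator_of_mem hx]
  have h1 : rootDensity μ Q₁ x ≤ 2 * rootDensity μ Q₂ x := hx
  rcases eq_or_ne (rootDensity μ Q₂ x) 0 with h0 | h0
  · have : rootDensity μ Q₁ x = 0 := le_antisymm (by simpa [h0] using h1) (rootDensity_nonneg _ _ _)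
    simp [h0, this]
  · field_simp

lemma boundedRatio_truncatedRatio {μ Q₁ Q₂ : Measure X} [SigmaFinite μ] [SigmaFinite Q₁]
    [SigmaFinite Q₂] (h₁ : Q₁ ≪ μ) (h₂ : Q₂ ≪ μ) :
    BoundedRatio Q₁ Q₂ (ratioSet μ Q₁ Q₂) (truncatedRatio μ Q₁ Q₂) where
  measurableSet := measurableSet_ratioSet _ _ _
  measurable := measurable_truncatedRatio _ _ _
  nonneg := truncatedRatio_nonneg _ _ _
  le_four := truncatedRatio_le _ _ _
  restrict_eq := by
    have hB := measurableSet_ratioSet μ Q₁ Q₂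
    ext s hs
    rw [Measure.restrict_apply hs, withDensity_apply _ hs, ← lintegral_indicator hs,
      ← setLIntegral_rootDensity_sq h₁ (hs.inter hB), ← lintegral_indicator (hs.inter hB),
      ← lintegral_rootDensity_sq_mul h₂
        ((measurable_truncatedRatio μ Q₁ Q₂).ennreal_ofReal.indicator hs)]
    refine lintegral_congr fun x => ?_
    by_cases hxs : x ∈ s
    · by_cases hxB : x ∈ ratioSet μ Q₁ Q₂
      · simp only [hxs, hxB, Set.mem_inter_iff, and_self, Set.indicator_of_mem]
        rw [← ENNReal.ofReal_mul (sq_nonneg _), rootDensity_sq_mul_truncatedRatio _ _ _ hxB]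
      · simp [hxB, truncatedRatio]
    · simp [hxs]

lemma hellingerSq_ne_top {μ Q₁ Q₂ : Measure X} [SigmaFinite μ] [IsFiniteMeasure Q₁]
    [IsFiniteMeasure Q₂] (h₁ : Q₁ ≪ μ) (h₂ : Q₂ ≪ μ) : hellingerSq μ Q₁ Q₂ ≠ ∞ := by
  have hm₁ := measurable_rootDensity μ Q₁
  refine ne_top_of_le_ne_top (b := Q₁ Set.univ + Q₂ Set.univ) (by simp) ?_
  rw [← lintegral_rootDensity_sq h₁, ← lintegral_rootDensity_sq h₂,
    ← lintegral_add_left (by fun_prop)]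
  refine lintegral_mono fun x => ?_
  simp only
  rw [← ENNReal.ofReal_add (sq_nonneg _) (sq_nonneg _)]
  refine ENNReal.ofReal_le_ofReal ?_
  nlinarith [mul_nonneg (rootDensity_nonneg μ Q₁ x) (rootDensity_nonneg μ Q₂ x)]

/-- With s the quotient of the roots, s⁴ + 1 − 2s² = (s − 1)²(s + 1)², and s ≤ 2 on the set gives
the factor 9. Since both laws have mass one, subtracting 2s² removes the first-order term, and the
excess over 1 is of the order of the squared distance. -/
lemma integral_truncatedRatio_sq_le {μ Q₁ Q₂ : Measure X} [SigmaFinite μ]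
    [IsProbabilityMeasure Q₁] [IsProbabilityMeasure Q₂] (h₁ : Q₁ ≪ μ) (h₂ : Q₂ ≪ μ) :
    ∫ x, truncatedRatio μ Q₁ Q₂ x ^ 2 ∂Q₂ ≤ 1 + 9 * (hellingerSq μ Q₁ Q₂).toReal := by
  have hm₁ := measurable_rootDensity μ Q₁
  have hm₂ := measurable_rootDensity μ Q₂
  have hm := measurable_truncatedRatio μ Q₁ Q₂
  have hH := hellingerSq_ne_top h₁ h₂
  have key : (∫⁻ x, ENNReal.ofReal (truncatedRatio μ Q₁ Q₂ x ^ 2) ∂Q₂) + 1 ≤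
      9 * hellingerSq μ Q₁ Q₂ + 2 * 1 := by
    rw [← lintegral_rootDensity_sq_mul h₂ (by fun_prop)]
    -- The summand 1 on the left becomes the mass of `Q₂`, the 1 in `2 * 1` that of `Q₁`; then the
    -- claim is pointwise.
    nth_rewrite 1 [← measure_univ (μ := Q₂)]
    rw [← measure_univ (μ := Q₁), ← lintegral_rootDensity_sq h₁, ← lintegral_rootDensity_sq h₂,
      hellingerSq, ← lintegral_const_mul _ (by fun_prop), ← lintegral_const_mul _ (by fun_prop),
      ← lintegral_add_left (by fun_prop), ← lintegral_add_left (by fun_prop)]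
    refine lintegral_mono fun x => ?_
    simp only
    rw [← ENNReal.ofReal_ofNat 9, ← ENNReal.ofReal_ofNat 2, ← ENNReal.ofReal_mul (sq_nonneg _),
      ← ENNReal.ofReal_mul (by positivity), ← ENNReal.ofReal_mul (by positivity),
      ← ENNReal.ofReal_add (by positivity) (by positivity),
      ← ENNReal.ofReal_add (by positivity) (by positivity)]
    refine ENNReal.ofReal_le_ofReal ?_
    have ha := rootDensity_nonneg μ Q₁ x
    have hb := rootDensity_nonneg μ Q₂ x
    by_cases hx : x ∈ ratioSet μ Q₁ Q₂
    · have h1 := rootDensity_sq_mul_truncatedRatio _ _ _ hx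
      have h2 : rootDensity μ Q₁ x ≤ 2 * rootDensity μ Q₂ x := hx
      have hr : truncatedRatio μ Q₁ Q₂ x
          = (rootDensity μ Q₁ x / rootDensity μ Q₂ x) ^ 2 := by
        rw [truncatedRatio, Set.indicator_of_mem hx]
      rw [hr]
      generalize rootDensity μ Q₁ x = a at *
      generalize rootDensity μ Q₂ x = b at *
      rcases hb.eq_or_lt with h0 | h0
      · have : a = 0 := by linarith
        simp [← h0, this]
      · obtain ⟨s, hs⟩ : ∃ s, s = a / b := ⟨_, rfl⟩
        have has : a = s * b := by rw [hs]; field_simp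
        rw [← hs, has]
        have hs0 : 0 ≤ s := by rw [hs]; positivity
        have hs2 : s ≤ 2 := by rw [hs, div_le_iff₀ h0]; exact h2
        have h3 : (s ^ 2) ^ 2 + 1 ≤ 9 * (s - 1) ^ 2 + 2 * s ^ 2 := by
          have : (s + 1) ^ 2 ≤ 9 := by nlinarith
          nlinarith [mul_nonneg (sq_nonneg (s - 1)) (sub_nonneg.2 this)]
        nlinarith [mul_le_mul_of_nonneg_left h3 (sq_nonneg b)]
    · have hx' : 2 * rootDensity μ Q₂ x < rootDensity μ Q₁ x := not_le.1 hx
      have : truncatedRatio μ Q₁ Q₂ x = 0 := Set.indicator_of_notMem hx _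
      rw [this]
      nlinarith [sq_nonneg (rootDensity μ Q₁ x - rootDensity μ Q₂ x)]
  have hL : ∫⁻ x, ENNReal.ofReal (truncatedRatio μ Q₁ Q₂ x ^ 2) ∂Q₂ ≠ ∞ := by
    intro h
    rw [h, top_add, top_le_iff] at key
    exact ENNReal.add_ne_top.2 ⟨ENNReal.mul_ne_top (by simp) hH, by simp⟩ key
  rw [integral_eq_lintegral_of_nonneg_ae (.of_forall fun x => sq_nonneg _)
    (by fun_prop)]
  have h3 := ENNReal.toReal_mono
    (ENNReal.add_ne_top.2 ⟨ENNReal.mul_ne_top (by simp) hH, by simp⟩) key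
  rw [ENNReal.toReal_add hL (by simp), ENNReal.toReal_add (ENNReal.mul_ne_top (by simp) hH)
    (by simp), ENNReal.toReal_mul] at h3
  norm_num at h3
  linarith

/-- For roots a > 2b ≥ 0 one has a < 2(a − b). -/
lemma measure_compl_ratioSet_le {μ Q₁ Q₂ : Measure X} [SigmaFinite μ] [SigmaFinite Q₁]
    (h₁ : Q₁ ≪ μ) :
    Q₁ (ratioSet μ Q₁ Q₂)ᶜ ≤ 4 * ∫⁻ x in (ratioSet μ Q₁ Q₂)ᶜ,
      ENNReal.ofReal ((rootDensity μ Q₁ x - rootDensity μ Q₂ x) ^ 2) ∂μ := by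
  have hm₁ := measurable_rootDensity μ Q₁
  have hm₂ := measurable_rootDensity μ Q₂
  have hB := (measurableSet_ratioSet μ Q₁ Q₂).compl
  rw [← setLIntegral_rootDensity_sq h₁ hB, ← lintegral_const_mul _ (by fun_prop)]
  refine setLIntegral_mono' hB fun x hx => ?_
  have hx' : 2 * rootDensity μ Q₂ x < rootDensity μ Q₁ x := not_le.1 hx
  rw [← ENNReal.ofReal_ofNat 4, ← ENNReal.ofReal_mul (by positivity)]
  refine ENNReal.ofReal_le_ofReal ?_
  nlinarith [rootDensity_nonneg μ Q₁ x, rootDensity_nonneg μ Q₂ x]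

/-- For roots a > 2b the root p of `P` satisfies p ≤ (a − p) − 2(b − p), so a and b cannot both be
near p unless p is small. The constant 18 is not sharp; 5 would do. -/
lemma measure_compl_ratioSet_le_hellingerSq {μ P Q₁ Q₂ : Measure X} [SigmaFinite μ]
    [SigmaFinite P] (hP : P ≪ μ) :
    P (ratioSet μ Q₁ Q₂)ᶜ ≤ 18 * (hellingerSq μ Q₁ P + hellingerSq μ Q₂ P) := by
  have hm := measurable_rootDensity μ P
  have hm₁ := measurable_rootDensity μ Q₁
  have hm₂ := measurable_rootDensity μ Q₂
  have hB := (measurableSet_ratioSet μ Q₁ Q₂).compl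
  rw [← setLIntegral_rootDensity_sq hP hB, hellingerSq, hellingerSq,
    ← lintegral_add_left (by fun_prop), ← lintegral_const_mul _ (by fun_prop)]
  refine le_trans (setLIntegral_mono' hB fun x hx => ?_) (setLIntegral_le_lintegral _ _)
  have hx' : 2 * rootDensity μ Q₂ x < rootDensity μ Q₁ x := not_le.1 hx
  rw [← ENNReal.ofReal_ofNat 18, ← ENNReal.ofReal_add (sq_nonneg _) (sq_nonneg _),
    ← ENNReal.ofReal_mul (by positivity)]
  refine ENNReal.ofReal_le_ofReal ?_
  have hp := rootDensity_nonneg μ P x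
  have hb := rootDensity_nonneg μ Q₂ x
  generalize rootDensity μ Q₁ x = a at *
  generalize rootDensity μ Q₂ x = b at *
  generalize rootDensity μ P x = p at *
  have h : p ≤ (a - p) - 2 * (b - p) := by linarith
  nlinarith [pow_le_pow_left₀ hp h 2, sq_nonneg (2 * (a - p) + (b - p))]

end

end WeakId

/-! ### Contiguity and total variation of sample laws -/

namespace WeakId

variable {X : Type*} [MeasurableSpace X]

lemma tendsto_rootIndex : Tendsto rootIndex atTop toZero := by
  refine tendsto_comap_iff.2 ?_
  change Tendsto (fun n : ℕ => 1 / √(max (n : ℝ) 1)) atTop (𝓝 0)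
  simp only [one_div]
  exact (Real.tendsto_sqrt_atTop.comp
    (tendsto_atTop_mono (fun n => le_max_left _ _) tendsto_natCast_atTop_atTop)).inv_tendsto_atTop

lemma rootIndex_sq {n : ℕ} (hn : 1 ≤ n) : (rootIndex n).1 ^ 2 = 1 / n := by
  have : max (n : ℝ) 1 = n := max_eq_left (by exact_mod_cast hn)
  simp only [rootIndex, this]
  rw [div_pow, Real.sq_sqrt (Nat.cast_nonneg n), one_pow]

lemma lintegral_ofReal_sub_sq {P : Measure X} (g₁ g₂ : Lp ℝ 2 P) :
    ∫⁻ x, ENNReal.ofReal ((g₁ x - g₂ x) ^ 2) ∂P = ENNReal.ofReal (‖g₁ - g₂‖ ^ 2) := by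
  have h : ‖g₁ - g₂‖ₑ ^ (2 : ℝ) = ∫⁻ x, ‖(g₁ - g₂) x‖ₑ ^ (2 : ℝ) ∂P := by
    rw [Lp.enorm_def, eLpNorm_eq_lintegral_rpow_enorm_toReal (by simp) (by simp),
      ← ENNReal.rpow_mul]
    simp
  rw [ENNReal.ofReal_pow (norm_nonneg _), ofReal_norm, ← ENNReal.rpow_two, h]
  refine lintegral_congr_ae ?_
  filter_upwards [Lp.coeFn_sub g₁ g₂] with x hx
  rw [hx, Pi.sub_apply, ENNReal.rpow_two, ← ofReal_norm, ← ENNReal.ofReal_pow (norm_nonneg _),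
    Real.norm_eq_abs, sq_abs]

/-- Along two paths with scores `g₁` and `g₂` the laws of a single observation have bounded
ratios, up to sets of probability `o(1/n)`, with second moments `1 + O(1/n)`. -/
lemma exists_boundedRatio {P : ProbabilityMeasure X} {Q₁ Q₂ : Path X}
    {g₁ g₂ : Lp ℝ 2 (P : Measure X)} (h₁ : HasScore P Q₁ g₁) (h₂ : HasScore P Q₂ g₂) :
    ∃ (B : ℕ → Set X) (r : ℕ → X → ℝ) (c : ℕ → ℝ),
      (∀ n, BoundedRatio (Q₁ (rootIndex n) : Measure X) (Q₂ (rootIndex n) : Measure X)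
        (B n) (r n)) ∧
      (∀ᶠ n in atTop, ∫ x, r n x ^ 2 ∂(Q₂ (rootIndex n) : Measure X) ≤ 1 + c n) ∧
      Tendsto (fun n => n * (Q₁ (rootIndex n) : Measure X).real (B n)ᶜ) atTop (𝓝 0) ∧
      Tendsto (fun n => n * c n) atTop (𝓝 (9 * ‖g₁ - g₂‖ ^ 2)) := by
  set t : ℕ → ℝ := fun n => (rootIndex n).1 with ht
  set q₁ : ℕ → Measure X := fun n => (Q₁ (rootIndex n) : Measure X) with hq₁
  set q₂ : ℕ → Measure X := fun n => (Q₂ (rootIndex n) : Measure X) with hq₂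
  -- The dominating measure may vary with `n`, because the error in quadratic mean does not depend
  -- on it.
  set μ : ℕ → Measure X := fun n => (P : Measure X) + q₁ n + q₂ n with hμ
  have hpμ n : (P : Measure X) ≪ μ n :=
    (Measure.AbsolutelyContinuous.rfl.add_right _).add_right _
  have h1μ n : q₁ n ≪ μ n := by
    simp only [hμ]; rw [add_comm (P : Measure X)]
    exact (Measure.AbsolutelyContinuous.rfl.add_right _).add_right _
  have h2μ n : q₂ n ≪ μ n := by
    simp only [hμ]; rw [add_comm]
    exact Measure.AbsolutelyContinuous.rfl.add_right _
  have htpos n : 0 < t n := (rootIndex n).2.1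
  have ht0 : Tendsto t atTop (𝓝 0) := tendsto_comap_iff.1 tendsto_rootIndex
  have ht2 : Tendsto (fun n => ENNReal.ofReal (t n ^ 2)) atTop (𝓝 0) := by
    simpa using ENNReal.tendsto_ofReal (ht0.pow 2)
  set e₁ : ℕ → ℝ≥0∞ := fun n => dqmError (P : Measure X) (q₁ n) g₁ (t n) with he₁
  set e₂ : ℕ → ℝ≥0∞ := fun n => dqmError (P : Measure X) (q₂ n) g₂ (t n) with he₂
  have he₁0 : Tendsto e₁ atTop (𝓝 0) := h₁.comp tendsto_rootIndex
  have he₂0 : Tendsto e₂ atTop (𝓝 0) := h₂.comp tendsto_rootIndex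
  have he0 : Tendsto (fun n => 4 * (e₁ n + e₂ n)) atTop (𝓝 0) := by
    simpa using ENNReal.Tendsto.const_mul (he₁0.add he₂0) (.inr (by simp : (4 : ℝ≥0∞) ≠ ∞))
  have hm₁ : Measurable g₁ := (Lp.stronglyMeasurable g₁).measurable
  have hm₂ : Measurable g₂ := (Lp.stronglyMeasurable g₂).measurable
  have hG := lintegral_ofReal_sub_sq g₁ g₂
  have hfin (g : Lp ℝ 2 (P : Measure X)) : ∫⁻ x, ENNReal.ofReal (g x ^ 2) ∂(P : Measure X) ≠ ∞ := by
    have : ∫⁻ x, ENNReal.ofReal (g x ^ 2) ∂(P : Measure X) = ENNReal.ofReal (‖g - 0‖ ^ 2) := by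
      rw [← lintegral_ofReal_sub_sq]
      refine lintegral_congr_ae ?_
      filter_upwards [Lp.coeFn_zero ℝ 2 (P : Measure X)] with x hx
      rw [hx, Pi.zero_apply, sub_zero]
    rw [this]; exact ENNReal.ofReal_ne_top
  have hell {q : ℕ → Measure X} {g : Lp ℝ 2 (P : Measure X)} [∀ n, IsFiniteMeasure (q n)]
      (hq : ∀ n, q n ≪ μ n) (he : Tendsto (fun n => dqmError (P : Measure X) (q n) g (t n)) atTop (𝓝 0)) :
      Tendsto (fun n => hellingerSq (μ n) (q n) (P : Measure X)) atTop (𝓝 0) := by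
    have h := ENNReal.Tendsto.mul ht2 (.inr (by simpa using hfin g))
      ((ENNReal.Tendsto.const_mul he (.inr (by simp : (4 : ℝ≥0∞) ≠ ∞))).add
        (tendsto_const_nhds (x := ∫⁻ x, ENNReal.ofReal (g x ^ 2) ∂(P : Measure X)))) (.inr (by simp))
    rw [zero_mul] at h
    exact tendsto_of_tendsto_of_tendsto_of_le_of_le tendsto_const_nhds h (fun _ => zero_le)
      fun n => hellingerSq_le (hpμ n) (hq n) (Lp.stronglyMeasurable g).measurable (htpos n)
  set B : ℕ → Set X := fun n => ratioSet (μ n) (q₁ n) (q₂ n) with hB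
  have hPB : Tendsto (fun n => (P : Measure X) (B n)ᶜ) atTop (𝓝 0) := by
    have h := ENNReal.Tendsto.const_mul ((hell h1μ he₁0).add (hell h2μ he₂0))
      (.inr (by simp : (18 : ℝ≥0∞) ≠ ∞))
    rw [add_zero, mul_zero] at h
    exact tendsto_of_tendsto_of_tendsto_of_le_of_le tendsto_const_nhds h (fun _ => zero_le)
      fun n => measure_compl_ratioSet_le_hellingerSq (hpμ n)
  have hnt {n : ℕ} (hn : 1 ≤ n) : (n : ℝ≥0∞) * ENNReal.ofReal (t n ^ 2) = 1 := by
    rw [ht]; simp only [rootIndex_sq hn]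
    rw [← ENNReal.ofReal_natCast, ← ENNReal.ofReal_mul (Nat.cast_nonneg n),
      mul_one_div_cancel (by exact_mod_cast (by lia : n ≠ 0)), ENNReal.ofReal_one]
  -- The factor t² = 1/n cancels `n`. What remains are vanishing errors and the integral of the
  -- integrable (g₁ − g₂)² over sets of vanishing `P`-measure.
  have hQB : Tendsto (fun n : ℕ => (n : ℝ≥0∞) * q₁ n (B n)ᶜ) atTop (𝓝 0) := by
    have h := ENNReal.Tendsto.const_mul (he0.add (tendsto_setLIntegral_zero
      (hG.trans_ne ENNReal.ofReal_ne_top) hPB)) (.inr (by simp : (4 : ℝ≥0∞) ≠ ∞))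
    rw [add_zero, mul_zero] at h
    refine tendsto_of_tendsto_of_tendsto_of_le_of_le' tendsto_const_nhds h
      (.of_forall fun _ => zero_le) ?_
    filter_upwards [eventually_ge_atTop 1] with n hn
    calc (n : ℝ≥0∞) * q₁ n (B n)ᶜ
        ≤ n * (4 * (ENNReal.ofReal (t n ^ 2) * (4 * (e₁ n + e₂ n) +
          ∫⁻ x in (B n)ᶜ, ENNReal.ofReal ((g₁ x - g₂ x) ^ 2) ∂(P : Measure X)))) := by
          refine mul_le_mul_right ((measure_compl_ratioSet_le (h1μ n)).trans
            (mul_le_mul_right (setLIntegral_sub_sq_le (hpμ n) (h1μ n) (h2μ n) hm₁ hm₂ (htpos n)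
              (measurableSet_ratioSet _ _ _).compl) _)) _
      _ = (n * ENNReal.ofReal (t n ^ 2)) * (4 * (4 * (e₁ n + e₂ n) +
          ∫⁻ x in (B n)ᶜ, ENNReal.ofReal ((g₁ x - g₂ x) ^ 2) ∂(P : Measure X))) := by ring
      _ = _ := by rw [hnt hn, one_mul]
  set k : ℕ → ℝ≥0∞ := fun n => 4 * (e₁ n + e₂ n) + ENNReal.ofReal (‖g₁ - g₂‖ ^ 2) with hk
  have hk0 : Tendsto k atTop (𝓝 (ENNReal.ofReal (‖g₁ - g₂‖ ^ 2))) := by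
    simpa only [zero_add] using he0.add_const (ENNReal.ofReal (‖g₁ - g₂‖ ^ 2))
  have hk1 := (ENNReal.tendsto_toReal ENNReal.ofReal_ne_top).comp hk0
  rw [ENNReal.toReal_ofReal (sq_nonneg _)] at hk1
  refine ⟨B, fun n => truncatedRatio (μ n) (q₁ n) (q₂ n), fun n => 9 * (t n ^ 2 * (k n).toReal),
    fun n => boundedRatio_truncatedRatio (h1μ n) (h2μ n), ?_, ?_, ?_⟩
  -- `k n` may be infinite for small `n`, and then its `toReal` bounds nothing.
  · filter_upwards [hk0.eventually (gt_mem_nhds ENNReal.ofReal_lt_top)] with n hn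
    refine (integral_truncatedRatio_sq_le (h1μ n) (h2μ n)).trans ?_
    have hle : hellingerSq (μ n) (q₁ n) (q₂ n) ≤ ENNReal.ofReal (t n ^ 2) * k n := by
      have := setLIntegral_sub_sq_le (hpμ n) (h1μ n) (h2μ n) hm₁ hm₂ (htpos n) .univ
      rwa [Measure.restrict_univ, Measure.restrict_univ, hG] at this
    have h3 := ENNReal.toReal_mono (ENNReal.mul_ne_top ENNReal.ofReal_ne_top hn.ne) hle
    rw [ENNReal.toReal_mul, ENNReal.toReal_ofReal (sq_nonneg _)] at h3
    linarith
  · have := (ENNReal.tendsto_toReal ENNReal.zero_ne_top).comp hQB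
    simpa [Function.comp_def, measureReal_def] using this
  · refine (hk1.const_mul 9).congr' ?_
    filter_upwards [eventually_ge_atTop 1] with n hn
    simp only [Function.comp_apply, ht]
    rw [rootIndex_sq hn]
    have : (n : ℝ) ≠ 0 := by exact_mod_cast (by lia : n ≠ 0)
    field_simp

instance {Q : Path X} {n : ℕ} : IsProbabilityMeasure (sampleLaw Q n) := by
  unfold sampleLaw; infer_instance

/-- The sample laws along two paths that tend to `P` in quadratic mean are contiguous. -/
lemma tendsto_sampleLaw_zero {P : ProbabilityMeasure X} {Q₁ Q₂ : Path X}
    {g₁ g₂ : Lp ℝ 2 (P : Measure X)} (h₁ : HasScore P Q₁ g₁) (h₂ : HasScore P Q₂ g₂)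
    {A : ∀ n, Set (Fin n → X)} (hA : Tendsto (fun n => sampleLaw Q₂ n (A n)) atTop (𝓝 0)) :
    Tendsto (fun n => sampleLaw Q₁ n (A n)) atTop (𝓝 0) := by
  obtain ⟨B, r, c, hr, hrc, hB, hc⟩ := exists_boundedRatio h₁ h₂
  -- The sets `A n` are arbitrary; a measurable hull under the second law has the same outer measure
  -- there and still covers under the first.
  set T : ∀ n, Set (Fin n → X) := fun n => toMeasurable (sampleLaw Q₂ n) (A n)
  have hT n : MeasurableSet (T n) := measurableSet_toMeasurable _ _
  have hT0 : Tendsto (fun n => (sampleLaw Q₂ n).real (T n)) atTop (𝓝 0) := by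
    have := (ENNReal.tendsto_toReal ENNReal.zero_ne_top).comp hA
    simpa [Function.comp_def, measureReal_def, T] using this
  have hle (l : ℝ) (hl : 0 < l) : ∀ᶠ n : ℕ in atTop, (sampleLaw Q₁ n).real (T n) ≤
      n * (Q₁ (rootIndex n) : Measure X).real (B n)ᶜ + l * (sampleLaw Q₂ n).real (T n) +
        Real.exp (n * c n) / l := by
    filter_upwards [hrc] with n hn
    have := (hr n).integral_pi_le_contiguous n (U := (T n).indicator 1)
      (measurable_one.indicator (hT n)) (fun x => Set.indicator_nonneg (by simp) x)
      (fun x => Set.indicator_le_self' (by simp) x) hn hl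
    rwa [integral_indicator_one (hT n), integral_indicator_one (hT n)] at this
  have hlim : Tendsto (fun n => (sampleLaw Q₁ n).real (T n)) atTop (𝓝 0) := by
    refine tendsto_order.2 ⟨fun a ha => .of_forall fun n => ha.trans_le measureReal_nonneg,
      fun a ha => ?_⟩
    set E := Real.exp (9 * ‖g₁ - g₂‖ ^ 2)
    have hE : 0 < E := Real.exp_pos _
    -- With this `l` the second-moment term tends to a/2, while the other two terms vanish.
    have hl : 0 < 2 * E / a := by positivity
    have h := (hB.add (hT0.const_mul (2 * E / a))).add
      ((Real.continuous_exp.continuousAt.tendsto.comp hc).div_const (2 * E / a))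
    have hlt : 0 + 2 * E / a * 0 + E / (2 * E / a) < a := by
      have : E / (2 * E / a) = a / 2 := by field_simp
      rw [this]; linarith
    filter_upwards [hle _ hl, h.eventually (gt_mem_nhds hlt)] with n h3 h4
    exact h3.trans_lt h4
  have hlim' : Tendsto (fun n => sampleLaw Q₁ n (T n)) atTop (𝓝 0) := by
    have := ENNReal.tendsto_ofReal hlim
    simpa [measureReal_def] using this
  exact tendsto_of_tendsto_of_tendsto_of_le_of_le tendsto_const_nhds hlim' (fun _ => zero_le)
    fun n => measure_mono (subset_toMeasurable _ _)

/-- If the scores of two paths are close, then the sample laws are close in total variation. -/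
lemma exists_integral_sampleLaw_le {P : ProbabilityMeasure X} {Q₁ Q₂ : Path X}
    {g₁ g₂ : Lp ℝ 2 (P : Measure X)} (h₁ : HasScore P Q₁ g₁) (h₂ : HasScore P Q₂ g₂) {l : ℝ}
    (hl : 0 < l) :
    ∃ d : ℕ → ℝ, Tendsto d atTop (𝓝 (l + (Real.exp (9 * ‖g₁ - g₂‖ ^ 2) - 1) / l)) ∧
      ∀ᶠ n in atTop, ∀ U : (Fin n → X) → ℝ, Measurable U → (∀ x, 0 ≤ U x) → (∀ x, U x ≤ 1) →
        ∫ x, U x ∂(sampleLaw Q₁ n) ≤ (∫ x, U x ∂(sampleLaw Q₂ n)) + d n := by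
  obtain ⟨B, r, c, hr, hrc, hB, hc⟩ := exists_boundedRatio h₁ h₂
  refine ⟨_, ?_, hrc.mono fun n hn U hU hU0 hU1 =>
    (hr n).integral_pi_le_add n hU hU0 hU1 hn hl⟩
  have h := (hB.add_const l).add
    ((((Real.continuous_exp.continuousAt.tendsto.comp hc).sub_const 1).add
      (hB.const_mul 2)).div_const l)
  simpa using h

end WeakId

/-! ### Outer expectations -/

namespace WeakId

section

variable {Ω : Type*} [MeasurableSpace Ω] {μ ν : Measure Ω} {f g : Ω → ℝ}

/-- Nonnegativity bounds the set of integrals of majorants below, so that `sInf` is a true infimum.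
-/
lemma outerExp_le_integral {U : Ω → ℝ} (hf0 : ∀ ω, 0 ≤ f ω) (hU : Measurable U)
    (hi : Integrable U μ) (h : ∀ ω, f ω ≤ U ω) : outerExp μ f ≤ ∫ ω, U ω ∂μ := by
  refine csInf_le ⟨0, ?_⟩ ⟨U, hU, hi, h, rfl⟩
  rintro _ ⟨V, -, -, hV, rfl⟩
  exact integral_nonneg fun ω => (hf0 ω).trans (hV ω)

variable [IsProbabilityMeasure μ] [IsProbabilityMeasure ν]

lemma le_outerExp {b : ℝ} (hf1 : ∀ ω, f ω ≤ 1)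
    (h : ∀ U : Ω → ℝ, Measurable U → Integrable U μ → (∀ ω, f ω ≤ U ω) → b ≤ ∫ ω, U ω ∂μ) :
    b ≤ outerExp μ f := by
  refine le_csInf ⟨_, fun _ => 1, measurable_const, integrable_const 1, hf1, rfl⟩ ?_
  rintro _ ⟨U, hU, hi, hfU, rfl⟩
  exact h U hU hi hfU

lemma outerExp_le_one (hf0 : ∀ ω, 0 ≤ f ω) (hf1 : ∀ ω, f ω ≤ 1) : outerExp μ f ≤ 1 := by
  simpa using outerExp_le_integral (μ := μ) hf0 measurable_const (integrable_const 1) hf1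

/-- A majorant of a function with values in [0, 1] may be cut off at 1, so measurable test functions
with values in [0, 1] suffice. -/
lemma outerExp_le_outerExp_add {d : ℝ} (hf0 : ∀ ω, 0 ≤ f ω) (hf1 : ∀ ω, f ω ≤ 1)
    (h : ∀ U : Ω → ℝ, Measurable U → (∀ ω, 0 ≤ U ω) → (∀ ω, U ω ≤ 1) →
      ∫ ω, U ω ∂μ ≤ (∫ ω, U ω ∂ν) + d) : outerExp μ f ≤ outerExp ν f + d := by
  rw [← sub_le_iff_le_add]
  refine le_outerExp hf1 fun U hU hi hfU => ?_
  rw [sub_le_iff_le_add]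
  set V : Ω → ℝ := fun ω => min (U ω) 1 with hV
  have hVm : Measurable V := hU.min measurable_const
  have hV0 ω : 0 ≤ V ω := le_min ((hf0 ω).trans (hfU ω)) zero_le_one
  have hV1 ω : V ω ≤ 1 := min_le_right _ _
  have hVi (ρ : Measure Ω) [IsProbabilityMeasure ρ] : Integrable V ρ :=
    .of_bound hVm.aestronglyMeasurable 1 (.of_forall fun ω => by
      rw [Real.norm_of_nonneg (hV0 ω)]; exact hV1 ω)
  calc outerExp μ f ≤ ∫ ω, V ω ∂μ :=
        outerExp_le_integral hf0 hVm (hVi μ) fun ω => le_min (hfU ω) (hf1 ω)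
    _ ≤ (∫ ω, V ω ∂ν) + d := h V hVm hV0 hV1
    _ ≤ (∫ ω, U ω ∂ν) + d := by
        exact add_le_add_left (integral_mono (hVi ν) hi fun ω => min_le_left _ _) d

lemma outerExp_le_of_le_add {e : ℝ} (hf0 : ∀ ω, 0 ≤ f ω) (hg1 : ∀ ω, g ω ≤ 1)
    (h : ∀ ω, f ω ≤ g ω + e) : outerExp μ f ≤ outerExp μ g + e := by
  rw [← sub_le_iff_le_add]
  refine le_outerExp hg1 fun U hU hi hgU => ?_
  rw [sub_le_iff_le_add]
  refine (outerExp_le_integral hf0 (hU.add_const e) (hi.add (integrable_const e))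
    fun ω => (h ω).trans (by linarith [hgU ω])).trans_eq ?_
  rw [integral_add hi (integrable_const e)]
  simp

/-- Every majorant is at least 1 − e off a measurable hull of the exceptional set, and nonnegative
on it. -/
lemma mul_le_outerExp {e : ℝ} (hf0 : ∀ ω, 0 ≤ f ω) (hf1 : ∀ ω, f ω ≤ 1) :
    (1 - e) * (1 - μ.real {ω | e < |1 - f ω|}) ≤ outerExp μ f := by
  refine le_outerExp hf1 fun U hU hi hfU => ?_
  set T := toMeasurable μ {ω | e < |1 - f ω|} with hT
  have hTm : MeasurableSet T := measurableSet_toMeasurable _ _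
  have h1 : μ.real {ω | e < |1 - f ω|} = μ.real T := by
    rw [measureReal_def, measureReal_def, hT, measure_toMeasurable]
  calc (1 - e) * (1 - μ.real {ω | e < |1 - f ω|}) = ∫ ω in Tᶜ, (1 - e) ∂μ := by
        rw [h1, setIntegral_const, probReal_compl_eq_one_sub hTm, smul_eq_mul, mul_comm]
    _ ≤ ∫ ω in Tᶜ, U ω ∂μ := by
        refine setIntegral_mono_on (integrable_const _) hi.integrableOn hTm.compl fun ω hω => ?_
        have : ω ∉ {ω | e < |1 - f ω|} := fun h => hω (subset_toMeasurable _ _ h)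
        have h2 : 1 - f ω ≤ e := (le_abs_self _).trans (not_lt.1 this)
        linarith [hfU ω]
    _ ≤ ∫ ω, U ω ∂μ :=
        setIntegral_le_integral hi (.of_forall fun ω => (hf0 ω).trans (hfU ω))

end

/-! ### Tests and consistent estimators -/

variable {X : Type*} [MeasurableSpace X] {P : ProbabilityMeasure X} {Q₁ Q₂ : Path X}
  {g₁ g₂ : Lp ℝ 2 (P : Measure X)}

/-- By contiguity tests cannot have level below one along one path and tend to one along
another. -/
lemma not_levelAlong_of_powerOneAlong (h₁ : HasScore P Q₁ g₁) (h₂ : HasScore P Q₂ g₂)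
    {φ : Tests X} {α : ℝ} (hα : α < 1) (hφ : PowerOneAlong φ Q₂) : ¬ LevelAlong φ α Q₁ := by
  intro hl
  have hφ0 n (x : Fin n → X) : 0 ≤ (φ n x : ℝ) := (φ n x).2.1
  have hφ1 n (x : Fin n → X) : (φ n x : ℝ) ≤ 1 := (φ n x).2.2
  obtain ⟨e, he0, heα⟩ : ∃ e : ℝ, 0 < e ∧ α < 1 - e :=
    ⟨(1 - α) / 2, by linarith, by linarith⟩
  have h0 := tendsto_sampleLaw_zero h₁ h₂ (hφ e he0)
  have h1 := (ENNReal.tendsto_toReal ENNReal.zero_ne_top).comp h0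
  have h2 := (h1.const_sub 1).const_mul (1 - e)
  rw [ENNReal.toReal_zero, sub_zero, mul_one] at h2
  obtain ⟨a, ha, hae⟩ := exists_between heα
  have h3 : ∀ᶠ n in atTop, a ≤ outerExp (sampleLaw Q₁ n) fun x => (φ n x : ℝ) := by
    filter_upwards [h2.eventually (lt_mem_nhds hae)] with n hn
    exact hn.le.trans (mul_le_outerExp (hφ0 n) (hφ1 n))
  have h4 := le_limsup_of_frequently_le h3.frequently
    (isBoundedUnder_of ⟨1, fun n => outerExp_le_one (hφ0 n) (hφ1 n)⟩)
  exact absurd (ha.trans_le (h4.trans hl)) (lt_irrefl _)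

/-- By contiguity estimators are not consistent along two paths with distinct limits. -/
lemma not_consistentAlong {B : Type*} [NormedAddCommGroup B] {β : ProbabilityMeasure X → B}
    (h₁ : HasScore P Q₁ g₁) (h₂ : HasScore P Q₂ g₂) {b₁ b₂ : B}
    (hb₁ : Tendsto (fun t => β (Q₁ t)) toZero (𝓝 b₁))
    (hb₂ : Tendsto (fun t => β (Q₂ t)) toZero (𝓝 b₂)) (hb : b₁ ≠ b₂) {est : Estimators X B}
    (hc₁ : ConsistentAlong β est Q₁) : ¬ ConsistentAlong β est Q₂ := by
  intro hc₂
  -- A route from b₁ to b₂ through both parameter values and the estimate has four legs; they cannot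
  -- all be at most `e` with some strictly shorter.
  set e : ℝ := dist b₁ b₂ / 4 with he
  have hd : 0 < dist b₁ b₂ := dist_pos.2 hb
  have he0 : 0 < e := by positivity
  have hA := tendsto_sampleLaw_zero h₁ h₂ (hc₂ e he0)
  have hsum := (hc₁ e he0).add hA
  rw [add_zero] at hsum
  have h1 : ∀ᶠ n in atTop, dist (β (Q₁ (rootIndex n))) b₁ < e :=
    (hb₁.comp tendsto_rootIndex).eventually (Metric.ball_mem_nhds _ he0)
  have h2 : ∀ᶠ n in atTop, dist (β (Q₂ (rootIndex n))) b₂ < e :=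
    (hb₂.comp tendsto_rootIndex).eventually (Metric.ball_mem_nhds _ he0)
  obtain ⟨n, hn, hn₁, hn₂⟩ := ((hsum.eventually (gt_mem_nhds zero_lt_one)).and
    (h1.and h2)).exists
  -- The two sets of large estimation error cover the sample space, yet their probabilities under
  -- the first law add up to less than one.
  refine absurd hn (not_lt.2 ?_)
  rw [← measure_univ (μ := sampleLaw Q₁ n)]
  refine (measure_mono fun x _ => ?_).trans (measure_union_le _ _)
  by_contra hx
  simp only [Set.mem_union, Set.mem_ofPred_eq, not_or, not_lt, ← dist_eq_norm, abs_dist] at hx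
  have h3 := dist_triangle4 b₁ (β (Q₁ (rootIndex n))) (est n x) b₂
  have h4 := dist_triangle (est n x) (β (Q₂ (rootIndex n))) b₂
  rw [dist_comm b₁ (β _), dist_comm (β (Q₁ _)) (est n x)] at h3
  linarith [hx.1, hx.2]

end WeakId

/-! ### Rescaling of paths -/

namespace WeakId

noncomputable section

/-- The index `a t`, cut off at `1`. -/
def rescaleIndex (a : ℝ) (ha : 0 < a) (t : Set.Ioc (0 : ℝ) 1) : Set.Ioc (0 : ℝ) 1 :=
  ⟨min (a * t.1) 1, lt_min (mul_pos ha t.2.1) one_pos, min_le_right _ _⟩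

lemma tendsto_val_toZero : Tendsto Subtype.val toZero (𝓝 (0 : ℝ)) := tendsto_comap

lemma eventually_mul_le_one (a : ℝ) : ∀ᶠ t in toZero, a * t.1 ≤ 1 := by
  have h := tendsto_val_toZero.const_mul a
  rw [mul_zero] at h
  exact (h.eventually (gt_mem_nhds one_pos)).mono fun _ h => h.le

lemma tendsto_rescaleIndex (a : ℝ) (ha : 0 < a) :
    Tendsto (rescaleIndex a ha) toZero toZero := by
  refine tendsto_comap_iff.2 ?_
  have h := tendsto_val_toZero.const_mul a
  rw [mul_zero] at h
  refine h.congr' ?_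
  filter_upwards [eventually_mul_le_one a] with t ht
  exact (min_eq_left ht).symm

variable {X : Type*} [MeasurableSpace X] {P : ProbabilityMeasure X}

/-- For small t the new error at t is a² times the old error at a t. -/
lemma HasScore.rescale {Q Q' : Path X} {g : Lp ℝ 2 (P : Measure X)} (h : HasScore P Q g) {a : ℝ}
    (ha : 0 < a) (hQ : ∀ᶠ t in toZero, Q' t = Q.rescale a ha t) : HasScore P Q' (a • g) := by
  have h1 := ENNReal.Tendsto.const_mul (h.comp (tendsto_rescaleIndex a ha))
    (.inr (ENNReal.ofReal_ne_top (r := a ^ 2)))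
  rw [mul_zero] at h1
  refine h1.congr' ?_
  filter_upwards [hQ, eventually_mul_le_one a] with t ht hat
  have hidx : (rescaleIndex a ha t).1 = a * t.1 := min_eq_left hat
  have hQt : Q' t = Q (rescaleIndex a ha t) := ht
  have ht0 : t.1 ≠ 0 := t.2.1.ne'
  have hm : Measurable g := (Lp.stronglyMeasurable g).measurable
  rw [hQt, dqmError_congr (Lp.coeFn_smul a g), Function.comp_apply, hidx, dqmError, dqmError,
    ← lintegral_const_mul' _ _ ENNReal.ofReal_ne_top]
  refine lintegral_congr fun x => ?_
  rw [← ENNReal.ofReal_mul (sq_nonneg a), ← mul_pow]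
  congr 2
  simp only [Pi.smul_apply, smul_eq_mul]
  field_simp

variable {B : Type*} {M Mβ : Set (ProbabilityMeasure X)} {𝒮 : Set (Path X)}
  {β : ProbabilityMeasure X → B}

section

variable [TopologicalSpace B]

/-- The pertinent tangent set is a cone. -/
lemma smul_mem_pertinentTangentSet (h𝒮 : IsPathFamily M P 𝒮) {g : Lp ℝ 2 (P : Measure X)}
    (hg : g ∈ pertinentTangentSet P 𝒮 Mβ β) {a : ℝ} (ha : 0 < a) :
    a • g ∈ pertinentTangentSet P 𝒮 Mβ β := by
  obtain ⟨-, ⟨Q, hQ, hQM, hQg⟩, b, hb⟩ := hg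
  obtain ⟨Q', hQ', hval, hev⟩ := h𝒮.rescale Q hQ a ha
  have hs := hQg.rescale ha hev
  refine ⟨⟨Q', hQ', hs⟩, ⟨Q', hQ', fun t => ?_, hs⟩, b, fun R hR hRM hRg => ?_⟩
  · obtain ⟨s, hs⟩ := hval t
    exact hs ▸ hQM s
  -- Any path with score `a • g` is scaled back to one with score `g`, whose limit `b` is known;
  -- evaluation at index a t recovers the given path.
  · obtain ⟨R', hR', hval', hev'⟩ := h𝒮.rescale R hR a⁻¹ (inv_pos.2 ha)
    have hs' := hRg.rescale (inv_pos.2 ha) hev'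
    rw [inv_smul_smul₀ ha.ne'] at hs'
    have hlim := hb R' hR' (fun t => by obtain ⟨s, hs⟩ := hval' t; exact hs ▸ hRM s) hs'
    refine (hlim.comp (tendsto_rescaleIndex a ha)).congr' ?_
    filter_upwards [(tendsto_rescaleIndex a ha).eventually hev', eventually_mul_le_one a]
      with t ht hat
    have hidx : (rescaleIndex a ha t).1 = a * t.1 := min_eq_left hat
    have hR : R' (rescaleIndex a ha t) = R t := by
      rw [ht, Path.rescale]
      congr 1
      ext
      simp only [hidx]
      rw [inv_mul_cancel_left₀ ha.ne', min_eq_left t.2.2]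
    rw [Function.comp_apply, hR]

/-- Each score in the pertinent tangent set is induced by a pertinent path. -/
lemma exists_mem_pertinentPaths {g : Lp ℝ 2 (P : Measure X)}
    (hg : g ∈ pertinentTangentSet P 𝒮 Mβ β) : ∃ Q ∈ pertinentPaths P 𝒮 Mβ β, HasScore P Q g := by
  obtain ⟨Q, hQ, hQM, hQg⟩ := hg.2.1
  exact ⟨Q, ⟨hQ, hQM, g, hg, hQg⟩, hQg⟩

end

/-! ### Trigonometric test functions and equivariance in law -/

/-- The function `(1 + cos (s ℓ(b) + c)) / 2`. -/
def cosTest [NormedAddCommGroup B] [NormedSpace ℝ B] (ℓ : StrongDual ℝ B) (s c : ℝ) : B →ᵇ ℝ :=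
  .ofNormedAddCommGroup (fun b => (1 + Real.cos (s * ℓ b + c)) / 2) (by fun_prop) 1 fun b => by
    rw [Real.norm_eq_abs, abs_le]
    constructor <;> linarith [Real.neg_one_le_cos (s * ℓ b + c), Real.cos_le_one (s * ℓ b + c)]

section

variable [NormedAddCommGroup B] [NormedSpace ℝ B]

lemma cosTest_apply (ℓ : StrongDual ℝ B) (s c : ℝ) (b : B) :
    cosTest ℓ s c b = (1 + Real.cos (s * ℓ b + c)) / 2 := rfl

lemma cosTest_nonneg (ℓ : StrongDual ℝ B) (s c : ℝ) (b : B) : 0 ≤ cosTest ℓ s c b := by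
  rw [cosTest_apply]; linarith [Real.neg_one_le_cos (s * ℓ b + c)]

lemma cosTest_le_one (ℓ : StrongDual ℝ B) (s c : ℝ) (b : B) : cosTest ℓ s c b ≤ 1 := by
  rw [cosTest_apply]; linarith [Real.cos_le_one (s * ℓ b + c)]

/-- A translation of the argument is a change of phase, and the cosine is Lipschitz. Here `b'` plays
the parameter along the path and `b` its limit. -/
lemma abs_cosTest_sub_le (ℓ : StrongDual ℝ B) (s c : ℝ) (y b b' : B) :
    |cosTest ℓ s c y - cosTest ℓ s (c + s * ℓ b) (y - b')| ≤ |s * (ℓ b' - ℓ b)| := by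
  rw [cosTest_apply, cosTest_apply]
  have h := Real.abs_cos_sub_cos_le (s * ℓ y + c) (s * ℓ (y - b') + (c + s * ℓ b))
  have e : s * ℓ y + c - (s * ℓ (y - b') + (c + s * ℓ b)) = s * (ℓ b' - ℓ b) := by
    rw [map_sub]; ring
  rw [e] at h
  rw [← sub_div, add_sub_add_left_eq_sub, abs_div, abs_two]
  linarith [abs_nonneg (s * (ℓ b' - ℓ b))]

variable [MeasurableSpace B]

/-- The limit of the outer expectations of a trigonometric function of equivariant estimators. -/
lemma tendsto_outerExp_cosTest {Q : Path X} {est : Estimators X B} {L : Measure B} {b : B}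
    (hQ : WeaklyConvergesTo (sampleLaw Q) (fun n x => est n x - β (Q (rootIndex n))) L)
    (hb : Tendsto (fun t => β (Q t)) toZero (𝓝 b)) (ℓ : StrongDual ℝ B) (s c : ℝ) :
    Tendsto (fun n => outerExp (sampleLaw Q n) fun x => cosTest ℓ s c (est n x)) atTop
      (𝓝 (∫ y, cosTest ℓ s (c + s * ℓ b) y ∂L)) := by
  have h := hQ (cosTest ℓ s (c + s * ℓ b))
  have he : Tendsto (fun n => |s * (ℓ (β (Q (rootIndex n))) - ℓ b)|) atTop (𝓝 0) := by
    have h1 : Tendsto (fun n => ℓ (β (Q (rootIndex n)))) atTop (𝓝 (ℓ b)) :=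
      (ℓ.continuous.tendsto b).comp (hb.comp tendsto_rootIndex)
    have h2 := ((h1.sub_const (ℓ b)).const_mul s).abs
    simpa using h2
  have hlo := h.sub he
  have hup := h.add he
  rw [sub_zero] at hlo
  rw [add_zero] at hup
  refine tendsto_of_tendsto_of_tendsto_of_le_of_le hlo hup (fun n => ?_) (fun n => ?_)
  · rw [sub_le_iff_le_add]
    refine outerExp_le_of_le_add (fun _ => cosTest_nonneg _ _ _ _)
      (fun _ => cosTest_le_one _ _ _ _) fun x => ?_
    linarith [(abs_le.1 (abs_cosTest_sub_le ℓ s c (est n x) b (β (Q (rootIndex n))))).1]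
  · refine outerExp_le_of_le_add (fun _ => cosTest_nonneg _ _ _ _)
      (fun _ => cosTest_le_one _ _ _ _) fun x => ?_
    linarith [(abs_le.1 (abs_cosTest_sub_le ℓ s c (est n x) b (β (Q (rootIndex n))))).2]

variable {βP : Lp ℝ 2 (P : Measure X) → B}

/-- Equivariance forces the limit law, shifted by any two values of the local map, to be the same,
as far as trigonometric functions can tell. -/
lemma integral_cosTest_le (h𝒮 : IsPathFamily M P 𝒮) (hβ : IsWeaklyRegular P 𝒮 Mβ β βP)
    {est : Estimators X B} {L : Measure B} (hest : IsEquivariantInLaw P 𝒮 Mβ β est L)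
    {g₁ g₂ : Lp ℝ 2 (P : Measure X)} (hg₁ : g₁ ∈ pertinentTangentSet P 𝒮 Mβ β)
    (hg₂ : g₂ ∈ pertinentTangentSet P 𝒮 Mβ β) (ℓ : StrongDual ℝ B) (s c : ℝ) :
    ∫ y, cosTest ℓ s (c + s * ℓ (βP g₁)) y ∂L ≤ ∫ y, cosTest ℓ s (c + s * ℓ (βP g₂)) y ∂L := by
  -- Paths with scores `a • g₁` and `a • g₂` have the same limits of the parameter as for a = 1, but
  -- scores at distance a‖g₁ − g₂‖.
  have key (l : ℝ) (hl : 0 < l) (a : ℝ) (ha : 0 < a) :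
      ∫ y, cosTest ℓ s (c + s * ℓ (βP g₁)) y ∂L ≤ (∫ y, cosTest ℓ s (c + s * ℓ (βP g₂)) y ∂L) +
        (l + (Real.exp (9 * (a * ‖g₁ - g₂‖) ^ 2) - 1) / l) := by
    have ha₁ := smul_mem_pertinentTangentSet h𝒮 hg₁ ha
    have ha₂ := smul_mem_pertinentTangentSet h𝒮 hg₂ ha
    obtain ⟨Q₁, hQ₁, hs₁⟩ := exists_mem_pertinentPaths ha₁
    obtain ⟨Q₂, hQ₂, hs₂⟩ := exists_mem_pertinentPaths ha₂
    obtain ⟨d, hd, hle⟩ := exists_integral_sampleLaw_le hs₁ hs₂ hl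
    rw [← smul_sub, norm_smul, Real.norm_of_nonneg ha.le] at hd
    have h₁ := tendsto_outerExp_cosTest (hest Q₁ hQ₁) (hβ.tendsto Q₁ hQ₁ _ hs₁) ℓ s c
    have h₂ := tendsto_outerExp_cosTest (hest Q₂ hQ₂) (hβ.tendsto Q₂ hQ₂ _ hs₂) ℓ s c
    rw [hβ.homogeneous _ hg₁ a ha ha₁] at h₁
    rw [hβ.homogeneous _ hg₂ a ha ha₂] at h₂
    refine le_of_tendsto_of_tendsto h₁ (h₂.add hd) ?_
    filter_upwards [hle] with n hn
    exact outerExp_le_outerExp_add (fun _ => cosTest_nonneg _ _ _ _)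
      (fun _ => cosTest_le_one _ _ _ _) hn
  -- First a → 0 with `l` fixed, which removes the quotient by `l`; then `l` is arbitrary.
  refine le_of_forall_pos_le_add fun l hl => ?_
  have hcont : Continuous fun a : ℝ => (∫ y, cosTest ℓ s (c + s * ℓ (βP g₂)) y ∂L) +
        (l + (Real.exp (9 * (a * ‖g₁ - g₂‖) ^ 2) - 1) / l) := by fun_prop
  have hlim := (hcont.tendsto 0).mono_left (nhdsWithin_le_nhds (s := Set.Ioi 0))
  simp only [zero_mul, zero_pow two_ne_zero, mul_zero, Real.exp_zero, sub_self, zero_div,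
    add_zero] at hlim
  exact ge_of_tendsto hlim (eventually_mem_nhdsWithin.mono fun a ha => key l hl a ha)

variable [BorelSpace B]

lemma integral_cosTest {L : Measure B} [IsProbabilityMeasure L] (ℓ : StrongDual ℝ B) (s c : ℝ) :
    ∫ y, cosTest ℓ s c y ∂L = (1 + ∫ y, Real.cos (s * ℓ y + c) ∂L) / 2 := by
  have hi : Integrable (fun y => Real.cos (s * ℓ y + c)) L :=
    .of_bound (by fun_prop : Measurable _).aestronglyMeasurable 1
      (.of_forall fun y => Real.abs_cos_le_one _)
  simp only [cosTest_apply]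
  rw [integral_div, integral_add (integrable_const 1) hi]
  simp

/-- A probability law is not invariant under shifts in a direction that `ℓ` detects. -/
lemma not_forall_integral_cos_eq {L : Measure B} [IsProbabilityMeasure L] (ℓ : StrongDual ℝ B)
    {k : ℝ} (hk : k ≠ 0) : ¬ ∀ s c : ℝ,
      ∫ y, Real.cos (s * ℓ y + (c + s * k)) ∂L = ∫ y, Real.cos (s * ℓ y + c) ∂L := by
  intro h
  have hm (s : ℝ) (m : ℕ) :
      ∫ y, Real.cos (s * ℓ y + m * (s * k)) ∂L = ∫ y, Real.cos (s * ℓ y) ∂L := by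
    induction m with
    | zero => simp
    | succ m ih => rw [← ih, ← h s (m * (s * k))]; simp only [Nat.cast_succ, add_mul, one_mul]
  -- At this frequency m + 1 shifts add up to the phase π, which reverses the sign of the integral.
  -- The frequency tends to zero as m grows, so the integrals also tend to 1.
  have h0 (m : ℕ) : ∫ y, Real.cos (Real.pi / ((m + 1 : ℕ) * k) * ℓ y) ∂L = 0 := by
    have hm0 : ((m + 1 : ℕ) : ℝ) ≠ 0 := by positivity
    have h1 := hm (Real.pi / ((m + 1 : ℕ) * k)) (m + 1)
    have e : ((m + 1 : ℕ) : ℝ) * (Real.pi / ((m + 1 : ℕ) * k) * k) = Real.pi := by field_simp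
    simp only [e, Real.cos_add_pi] at h1
    rw [integral_neg] at h1
    linarith
  have hlim : Tendsto (fun m : ℕ => ∫ y, Real.cos (Real.pi / ((m + 1 : ℕ) * k) * ℓ y) ∂L) atTop
      (𝓝 (∫ _, (1 : ℝ) ∂L)) := by
    refine tendsto_integral_of_dominated_convergence (fun _ => 1)
      (fun m => (by fun_prop : Measurable _).aestronglyMeasurable) (integrable_const 1)
      (fun m => .of_forall fun y => Real.abs_cos_le_one _) (.of_forall fun y => ?_)
    have h1 : Tendsto (fun m : ℕ => Real.pi / ((m + 1 : ℕ) * k)) atTop (𝓝 0) := by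
      have h2 := (tendsto_one_div_add_atTop_nhds_zero_nat (𝕜 := ℝ)).mul_const (Real.pi / k)
      rw [zero_mul] at h2
      refine h2.congr fun m => ?_
      push_cast
      rw [div_mul_div_comm, one_mul]
    have h3 := (Real.continuous_cos.tendsto _).comp (h1.mul_const (ℓ y))
    simpa [Function.comp_def] using h3
  simp only [h0] at hlim
  have := tendsto_nhds_unique hlim tendsto_const_nhds
  simp at this

/-- Equivariant estimators exist only if the local map is constant. -/
lemma eq_of_isEquivariantInLaw (h𝒮 : IsPathFamily M P 𝒮) (hβ : IsWeaklyRegular P 𝒮 Mβ β βP)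
    {est : Estimators X B} {L : Measure B} [IsProbabilityMeasure L]
    (hest : IsEquivariantInLaw P 𝒮 Mβ β est L) {g₁ g₂ : Lp ℝ 2 (P : Measure X)}
    (hg₁ : g₁ ∈ pertinentTangentSet P 𝒮 Mβ β) (hg₂ : g₂ ∈ pertinentTangentSet P 𝒮 Mβ β) :
    βP g₁ = βP g₂ := by
  by_contra hne
  -- Hahn–Banach reduces the problem to shifts on the line.
  obtain ⟨ℓ, -, hℓ⟩ := exists_dual_vector ℝ (βP g₁ - βP g₂) (norm_ne_zero_iff.2 (sub_ne_zero.2 hne))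
  have hk : ℓ (βP g₁) - ℓ (βP g₂) ≠ 0 := by
    rw [← map_sub, hℓ]
    exact norm_ne_zero_iff.2 (sub_ne_zero.2 hne)
  refine not_forall_integral_cos_eq (L := L) ℓ hk fun s c => ?_
  -- The phase is chosen so that the shift belonging to g₂ cancels.
  have h := le_antisymm
    (integral_cosTest_le h𝒮 hβ hest hg₁ hg₂ ℓ s (c - s * ℓ (βP g₂)))
    (integral_cosTest_le h𝒮 hβ hest hg₂ hg₁ ℓ s (c - s * ℓ (βP g₂)))
  rw [integral_cosTest, integral_cosTest, sub_add_cancel] at h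
  have e : c - s * ℓ (βP g₂) + s * ℓ (βP g₁) = c + s * (ℓ (βP g₁) - ℓ (βP g₂)) := by ring
  rw [e] at h
  linarith

end

end

end WeakId

theorem mainTheorem1 {X B : Type*} [MeasurableSpace X]
    [NormedAddCommGroup B] [NormedSpace ℝ B] [CompleteSpace B] [MeasurableSpace B] [BorelSpace B]
    (M Mβ : Set (ProbabilityMeasure X)) (_hMβ : Mβ ⊆ M)
    (P : ProbabilityMeasure X) (_hP : P ∈ M)
    (𝒮 : Set (WeakId.Path X)) (_h𝒮 : WeakId.IsPathFamily M P 𝒮)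
    (β : ProbabilityMeasure X → B) (βP : Lp ℝ 2 (P : Measure X) → B)
    (_hβ : WeakId.IsWeaklyRegular P 𝒮 Mβ β βP)
    (_hnontrivial : ∃ g₁ ∈ WeakId.pertinentTangentSet P 𝒮 Mβ β,
      ∃ g₂ ∈ WeakId.pertinentTangentSet P 𝒮 Mβ β, βP g₁ ≠ βP g₂) :
    -- no consistent estimators, not even along just two paths with distinct limits of `β`
    ((¬ ∃ est : WeakId.Estimators X B, WeakId.IsConsistent P 𝒮 Mβ β est) ∧
      ∀ Q₁ ∈ WeakId.pertinentPaths P 𝒮 Mβ β, ∀ Q₂ ∈ WeakId.pertinentPaths P 𝒮 Mβ β,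
        ∀ g₁ g₂, WeakId.HasScore P Q₁ g₁ → WeakId.HasScore P Q₂ g₂ → βP g₁ ≠ βP g₂ →
          ¬ ∃ est : WeakId.Estimators X B,
            WeakId.ConsistentAlong β est Q₁ ∧ WeakId.ConsistentAlong β est Q₂) ∧
    -- no consistent nontrivial tests, not even along just one null and one alternative path
    ((∀ (B₀ B₁ : Set B) (α : ℝ), α < 1 → WeakId.NontrivialTesting P 𝒮 Mβ β βP B₀ B₁ →
        ¬ ∃ φ : WeakId.Tests X, WeakId.IsConsistentTest P 𝒮 Mβ β βP B₀ B₁ α φ) ∧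
      ∀ Q₀ ∈ WeakId.pertinentPaths P 𝒮 Mβ β, ∀ Q₁ ∈ WeakId.pertinentPaths P 𝒮 Mβ β,
        ∀ α : ℝ, α < 1 →
          ¬ ∃ φ : WeakId.Tests X, WeakId.LevelAlong φ α Q₀ ∧ WeakId.PowerOneAlong φ Q₁) ∧
    -- no estimators that are equivariant in law with a separable limit law
    ¬ ∃ (est : WeakId.Estimators X B) (L : Measure B), IsProbabilityMeasure L ∧
      WeakId.IsSeparableLaw L ∧ WeakId.IsEquivariantInLaw P 𝒮 Mβ β est L := by
  have hpart1 : ∀ Q₁ ∈ WeakId.pertinentPaths P 𝒮 Mβ β, ∀ Q₂ ∈ WeakId.pertinentPaths P 𝒮 Mβ β,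
      ∀ g₁ g₂, WeakId.HasScore P Q₁ g₁ → WeakId.HasScore P Q₂ g₂ → βP g₁ ≠ βP g₂ →
        ¬ ∃ est : WeakId.Estimators X B,
          WeakId.ConsistentAlong β est Q₁ ∧ WeakId.ConsistentAlong β est Q₂ := by
    rintro Q₁ hQ₁ Q₂ hQ₂ g₁ g₂ h₁ h₂ hne ⟨est, hc₁, hc₂⟩
    exact WeakId.not_consistentAlong h₁ h₂ (_hβ.tendsto Q₁ hQ₁ g₁ h₁) (_hβ.tendsto Q₂ hQ₂ g₂ h₂)
      hne hc₁ hc₂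
  obtain ⟨g₁, hg₁, g₂, hg₂, hne⟩ := _hnontrivial
  refine ⟨⟨?_, hpart1⟩, ⟨?_, ?_⟩, ?_⟩
  · rintro ⟨est, hest⟩
    obtain ⟨Q₁, hQ₁, h₁⟩ := WeakId.exists_mem_pertinentPaths hg₁
    obtain ⟨Q₂, hQ₂, h₂⟩ := WeakId.exists_mem_pertinentPaths hg₂
    exact hpart1 Q₁ hQ₁ Q₂ hQ₂ g₁ g₂ h₁ h₂ hne ⟨est, hest Q₁ hQ₁, hest Q₂ hQ₂⟩
  · rintro B₀ B₁ α hα ⟨⟨f₀, hf₀, hB₀⟩, f₁, hf₁, hB₁⟩ ⟨φ, hφ⟩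
    obtain ⟨Q₀, hQ₀, h₀⟩ := WeakId.exists_mem_pertinentPaths hf₀
    obtain ⟨Q₁, hQ₁, h₁⟩ := WeakId.exists_mem_pertinentPaths hf₁
    exact WeakId.not_levelAlong_of_powerOneAlong h₀ h₁ hα (hφ.power Q₁ hQ₁ f₁ h₁ hB₁)
      (hφ.level Q₀ hQ₀ f₀ h₀ hB₀)
  · rintro Q₀ ⟨-, -, f₀, -, h₀⟩ Q₁ ⟨-, -, f₁, -, h₁⟩ α hα ⟨φ, hl, hp⟩
    exact WeakId.not_levelAlong_of_powerOneAlong h₀ h₁ hα hp hl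
  · rintro ⟨est, L, hL, -, hest⟩
    exact hne (WeakId.eq_of_isEquivariantInLaw _h𝒮 _hβ hest hg₁ hg₂)
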